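/- **Diagrams and $\ltimes$.** Let $\underline{Cat}$ be the category whose objects are pairs $\underline D=\{D,R\}$ of a category $D$ and a functor $R:D\to Cat$ to small categories; a morphism $\{D,R\}\to\{D',R'\}$ is a pair $\{F,\rho\}$ of a functor $F:D\to D'$ and a natural transformation $\rho:R'\circ F\Rightarrow R$. The semi-direct product $\underline D\ltimes\underline D'$ has as base the category of pairs $\{d,\psi:R(d)\to D'\}$, with morphisms $\{f:d_1\to d_2,\ \phi:\psi_1\Rightarrow\psi_2\circ R(f)\}$, and it sends $\{d,\psi\}$ to the category of pairs $(a,b)$, $a\in R(d)$, $b\in R'(\psi(a))$, with morphisms $(\alpha:a_1\to a_2,\ \beta:R'(\psi(\alpha))(b_1)\to b_2)$. The unit $\underline{\mathbf 1}$ is the one-object category mapped to itself. (Iterated products are bracketed to the right.) **Simplicial sets.** $\underline{SSet}\in\underline{Cat}$ sends a simplicial set $\mathcal S$ to its category of elements $S$ (objects: the simplices; morphisms: simplicial operators carrying one simplex to another). Its multiplication $\{\Delta,\delta\}:\underline{SSet}\ltimes\underline{SSet}\to\underline{SSet}$ is the diagonal, $\Delta(\mathcal S,\psi)_n=\coprod_{s\in\mathcal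 S_n}\psi(s)_n$, with $\delta$ sending an $n$-simplex $(s,y)$ to the pair $(s,y)$; its unit $\underline{\mathbf 1}\to\underline{SSet}$ is the one-point simplicial set. **Fibrations.** Let $M$ be a category with a set $\mathcal I$ of objects (generators). For $I\in\mathcal I$ let $I[n]$ be the constant diagram with value $I$ over $\Delta[n]$, an object of $SSet\ltimes M$. The $I$-points of $\mathcal D\in SSet\ltimes M$ are the simplicial set $n\mapsto Hom(I[n],\mathcal D)$. A morphism $\{f,\phi\}$ of $SSet\ltimes M$ is a *fibration* if $f$ is injective and, for every $I\in\mathcal I$, the induced map of $I$-points is a Kan fibration. The generators of $SSet\ltimes M$ are the $I[n]$, $I\in\mathcal I$, $n\ge 0$. The generators of $SSet$ are the $\Delta[n]$, and the generator of $\mathbf 1$ is its object. **The sequences.** Let $sset\subset SSet$ be the subcategory of all simplicial sets and injective maps. Put $\underline{sset}^{\circ 1}=\underline{sset}$, and let $\underline{sset}^{\circ(k+1)}=\underline{sset}\circ\underline{sset}^{\circ k}$ be the subcategory of $\underline{sset}\ltimes\underline{sset}^{\circ k}$ with the same objects (pairs $\{\mathcal S,\psi\}$ with $\psi$ taking values in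 $sset^{\circ k}$) and with morphisms those $\{f,\phi\}$ with $f$ injective and all components of $\phi$ in $sset^{\circ k}$ that are fibrations in $SSet\ltimes SSet^{\ltimes k}$. Similarly let $\underline{sset}^{\circ 0}\circ\underline{\mathbf 1}=\underline{\mathbf 1}$ and $\underline{sset}^{\circ(k+1)}\circ\underline{\mathbf 1}=\underline{sset}\circ(\underline{sset}^{\circ k}\circ\underline{\mathbf 1})$. All of these carry the restricted functors to $Cat$. **Proposition.** The sequence $\{\underline{sset}^{\circ k}\}_{k\ge1}$ is stable with respect to the $\ltimes$-monoid structure on $\underline{SSet}$, i.e. 1. for all $k\ge 0$ and $0\le i\le k$ the multiplication of two neighbouring factors, $\underline{SSet}^{\ltimes i}\ltimes\{\Delta,\delta\}\ltimes\underline{SSet}^{\ltimes(k-i)}:\underline{SSet}^{\ltimes(k+2)}\to\underline{SSet}^{\ltimes(k+1)}$, restricts to $\underline{sset}^{\circ(k+2)}\to\underline{sset}^{\circ(k+1)}$; 2. for all $k\ge0$ and $0\le i\le k$ the insertion of the unit in front of the $i$-th factor (counted from $0$), $\underline{SSet}^{\ltimes(k+1)}\to\underline{SSet}^{\ltimes(k+2)}$,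 restricts to $\underline{sset}^{\circ(k+1)}\to\underline{sset}^{\circ(k+2)}$; and for all $k\ge 0$ the unit in the last factor, $\underline{SSet}^{\ltimes k}\ltimes\underline{\mathbf 1}\to\underline{SSet}^{\ltimes(k+1)}$, restricts to $\underline{sset}^{\circ k}\circ\underline{\mathbf 1}\to\underline{sset}^{\circ(k+1)}$. Consequently $\underline{sset}$ is itself a monoid: the right unitor $\underline{SSet}\ltimes\underline{\mathbf 1}\to\underline{SSet}$ restricts to $\underline{sset}\circ\underline{\mathbf 1}\to\underline{sset}$, and the restricted multiplication $\underline{sset}\circ\underline{sset}\to\underline{sset}$ and unit $\underline{\mathbf 1}\to\underline{sset}$ satisfy associativity on $\underline{sset}^{\circ3}$ and the left and right unit laws on $\underline{sset}$ and $\underline{sset}\circ\underline{\mathbf 1}$. Each of these laws holds up to canonical isomorphism: for the two morphisms $\{F,\rho\},\{F',\rho'\}:\{D,R\}\to\{E,Q\}$ compared there is exactly one natural isomorphism $\theta:F\cong F'$ with $\rho'\circ Q(\theta)=\rho$. -/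

import Mathlib

open CategoryTheory Opposite

universe u

/-! ### Diagrams of categories -/

/-- A diagram `{D, R}` of small categories: a category `D` together with a functor `R : D ⥤ Cat`. -/
structure CatDiagram : Type (u + 2) where
  base : Type (u + 1)
  [cat : Category.{u} base]
  fib : base ⥤ Cat.{0, u}

attribute [instance] CatDiagram.cat

namespace CatDiagram

/-- A morphism `{F, ρ} : {D, R} ⟶ {D', R'}` consists of a functor `F : D ⥤ D'` and a natural
transformation `ρ : F ⋙ R' ⟶ R`. -/
structure Hom (D E : CatDiagram.{u}) where
  functor : D.base ⥤ E.base
  trans : functor ⋙ E.fib ⟶ D.fib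

instance : Category CatDiagram.{u} where
  Hom := Hom
  id D := ⟨𝟭 _, 𝟙 D.fib⟩
  comp m n := ⟨m.functor ⋙ n.functor, Functor.whiskerLeft m.functor n.trans ≫ m.trans⟩
  id_comp m := by
    cases m
    exact congrArg (Hom.mk _) (Category.comp_id _)
  comp_id m := by
    cases m
    exact congrArg (Hom.mk _) (Category.id_comp _)
  assoc m n p := by
    refine congrArg (Hom.mk _) ?_
    ext x : 2
    exact (Category.assoc _ _ _).symm

end CatDiagram

/-! ### Total categories -/

section Total

variable {A B C : Type u} [Category.{0} A] [Category.{0} B] [Category.{0} C]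

theorem nat_obj {P : A ⥤ Cat.{0, u}} {Q : B ⥤ Cat.{0, u}} {G : A ⥤ B} (Φ : P ⟶ G ⋙ Q)
    {a a' : A} (f : a ⟶ a') (b : P.obj a) :
    (Q.map (G.map f)).toFunctor.obj ((Φ.app a).toFunctor.obj b) =
      (Φ.app a').toFunctor.obj ((P.map f).toFunctor.obj b) :=
  (Functor.congr_obj (congrArg Cat.Hom.toFunctor (Φ.naturality f)) b).symm

theorem total_map_eq {P : A ⥤ Cat.{0, u}} {Q : B ⥤ Cat.{0, u}} (G : A ⥤ B) (Φ : P ⟶ G ⋙ Q)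
    {p q : Grothendieck P} (f : p ⟶ q) :
    (Grothendieck.map Φ ⋙ Grothendieck.pre Q G).map f =
      Grothendieck.Hom.mk (G.map f.base)
        (eqToHom (nat_obj Φ f.base p.fiber) ≫ (Φ.app q.base).toFunctor.map f.fiber) := by
  refine congrArg (Grothendieck.Hom.mk _) (congrArg (· ≫ _) ?_)
  rw [Cat.Hom₂.eqToHom_toNatTrans, eqToHom_app]
  rfl

/-- The functor between Grothendieck constructions (objects: pairs `a`, `b ∈ P a`) given by a functor
of the bases and a natural transformation of the diagrams. -/
abbrev totalMap {P : A ⥤ Cat.{0, u}} {Q : B ⥤ Cat.{0, u}} (G : A ⥤ B) (Φ : P ⟶ G ⋙ Q) :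
    Grothendieck P ⥤ Grothendieck Q where
  obj p := ⟨G.obj p.base, (Φ.app p.base).toFunctor.obj p.fiber⟩
  map {p q} f := ⟨G.map f.base,
    eqToHom (nat_obj Φ f.base p.fiber) ≫ (Φ.app q.base).toFunctor.map f.fiber⟩
  map_id p := (total_map_eq G Φ (𝟙 p)).symm.trans
    ((Grothendieck.map Φ ⋙ Grothendieck.pre Q G).map_id p)
  map_comp {p q r} f g := by
    have h := (Grothendieck.map Φ ⋙ Grothendieck.pre Q G).map_comp f g
    rw [total_map_eq, total_map_eq, total_map_eq] at h
    exact h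

theorem totalMap_eq {P : A ⥤ Cat.{0, u}} {Q : B ⥤ Cat.{0, u}} (G : A ⥤ B) (Φ : P ⟶ G ⋙ Q) :
    totalMap G Φ = Grothendieck.map Φ ⋙ Grothendieck.pre Q G := by
  refine Functor.hext (fun _ => rfl) fun p q f => heq_of_eq ?_
  exact (total_map_eq G Φ f).symm

theorem totalMap_id (P : A ⥤ Cat.{0, u}) :
    totalMap (𝟭 A) (𝟙 P) = 𝟭 (Grothendieck P) := by
  rw [totalMap_eq]
  erw [Grothendieck.map_id_eq]
  rfl

theorem totalMap_comp {P : A ⥤ Cat.{0, u}} {Q : B ⥤ Cat.{0, u}} {R : C ⥤ Cat.{0, u}}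
    (G : A ⥤ B) (Φ : P ⟶ G ⋙ Q) (H : B ⥤ C) (Ψ : Q ⟶ H ⋙ R) :
    totalMap G Φ ⋙ totalMap H Ψ =
      totalMap (G ⋙ H) (Φ ≫ Functor.whiskerLeft G Ψ : P ⟶ (G ⋙ H) ⋙ R) := by
  rw [totalMap_eq, totalMap_eq, totalMap_eq]
  erw [Grothendieck.map_comp_eq]
  rfl

theorem totalMap_congr {P : A ⥤ Cat.{0, u}} {Q : B ⥤ Cat.{0, u}} {G G' : A ⥤ B}
    (e : G = G') {Φ : P ⟶ G ⋙ Q} {Φ' : P ⟶ G' ⋙ Q}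
    (h : ∀ a, Φ'.app a = Φ.app a ≫ eqToHom (by rw [e])) : totalMap G Φ = totalMap G' Φ' := by
  subst e
  congr 1
  ext a : 2
  rw [h]
  simp

theorem total_hext {P : A ⥤ Cat.{0, u}} {p q p' q' : Grothendieck P} (hp : p = p') (hq : q = q')
    {f : p ⟶ q} {f' : p' ⟶ q'} (hb : HEq f.base f'.base) (hf : HEq f.fiber f'.fiber) :
    HEq f f' := by
  subst hp hq
  obtain ⟨b, x⟩ := f
  obtain ⟨b', x'⟩ := f'
  obtain rfl : b = b' := eq_of_heq hb
  obtain rfl : x = x' := eq_of_heq hf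
  rfl

end Total

/-! ### The semi-direct product -/

theorem app_congr {A : Type*} [Category* A] {M : Type*} [Category* M] {P Q : A ⥤ M}
    (τ : P ⟶ Q) {a b : A} (e : a = b) :
    τ.app a = eqToHom (by rw [e]) ≫ τ.app b ≫ eqToHom (by rw [e]) := by
  subst e
  simp

/-- Objects of the base category of the semi-direct product of `{D, R}` with a diagram over `M`:
pairs of an object `d` of `D` and a functor `ψ : R d ⥤ M`. -/
structure SemiObj (D : CatDiagram.{u}) (M : Type (u + 1)) [Category.{u} M] where
  idx : D.base
  diag : D.fib.obj idx ⥤ M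

namespace SemiObj

section
variable {A B C E : Type u} [Category.{0} A] [Category.{0} B] [Category.{0} C] [Category.{0} E]
  {M : Type (u + 1)} [Category.{u} M]
  {ψ : A ⥤ M} {ψ' : B ⥤ M} {ψ'' : C ⥤ M} {ψ''' : E ⥤ M}

theorem trans_id_comp {I : A ⥤ A} (e : I = 𝟭 A) {G : A ⥤ B}
    (φ : ψ ⟶ G ⋙ ψ') (h₁ : ψ = I ⋙ ψ) (h₂ : I ⋙ G ⋙ ψ' = G ⋙ ψ') :
    (eqToHom h₁ ≫ Functor.whiskerLeft I φ) ≫ eqToHom h₂ = φ := by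
  subst e
  ext a
  simp

theorem trans_comp_id {I : B ⥤ B} (e : I = 𝟭 B) {G : A ⥤ B}
    (φ : ψ ⟶ G ⋙ ψ') (h₁ : ψ' = I ⋙ ψ') (h₂ : G ⋙ I ⋙ ψ' = G ⋙ ψ') :
    φ ≫ Functor.whiskerLeft G (eqToHom h₁) ≫ eqToHom h₂ = φ := by
  subst e
  ext a
  simp

theorem trans_assoc {G : A ⥤ B} {H : B ⥤ C} {K : C ⥤ E}
    {GH : A ⥤ C} {HK : B ⥤ E} {GHK : A ⥤ E} (e₁ : GH = G ⋙ H) (e₂ : HK = H ⋙ K)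
    (e₃ : GHK = G ⋙ H ⋙ K)
    (φ : ψ ⟶ G ⋙ ψ') (φ' : ψ' ⟶ H ⋙ ψ'') (φ'' : ψ'' ⟶ K ⋙ ψ''')
    (h₁ : G ⋙ H ⋙ ψ'' = GH ⋙ ψ'') (h₂ : GH ⋙ K ⋙ ψ''' = GHK ⋙ ψ''')
    (h₃ : H ⋙ K ⋙ ψ''' = HK ⋙ ψ''') (h₄ : G ⋙ HK ⋙ ψ''' = GHK ⋙ ψ''') :
    (φ ≫ Functor.whiskerLeft G φ' ≫ eqToHom h₁) ≫ Functor.whiskerLeft GH φ'' ≫ eqToHom h₂ =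
      φ ≫ Functor.whiskerLeft G (φ' ≫ Functor.whiskerLeft H φ'' ≫ eqToHom h₃) ≫ eqToHom h₄ := by
  subst e₁ e₂ e₃
  ext a
  simp

end

variable {D : CatDiagram.{u}} {M : Type (u + 1)} [Category.{u} M]

/-- Morphisms `{f, φ} : {d, ψ} ⟶ {d', ψ'}`: a morphism `f : d ⟶ d'` and a natural
transformation `φ : ψ ⟶ R f ⋙ ψ'`. -/
structure Hom (x y : SemiObj D M) where
  idx : x.idx ⟶ y.idx
  trans : x.diag ⟶ (D.fib.map idx).toFunctor ⋙ y.diag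

theorem Hom.ext' {x y : SemiObj D M} {g h : Hom x y} (e : g.idx = h.idx)
    (w : h.trans = g.trans ≫ eqToHom (by rw [e])) : g = h := by
  obtain ⟨i, t⟩ := g
  obtain ⟨j, s⟩ := h
  obtain rfl : i = j := e
  simp at w
  rw [w]

theorem fib_id (D : CatDiagram.{u}) (d : D.base) :
    (D.fib.map (𝟙 d)).toFunctor = 𝟭 _ := by
  rw [D.fib.map_id]; rfl

theorem fib_comp (D : CatDiagram.{u}) {d d' d'' : D.base} (f : d ⟶ d') (g : d' ⟶ d'') :
    (D.fib.map (f ≫ g)).toFunctor = (D.fib.map f).toFunctor ⋙ (D.fib.map g).toFunctor := by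
  rw [D.fib.map_comp]; rfl

instance : Category.{u} (SemiObj D M) where
  Hom := Hom
  id x := ⟨𝟙 _, eqToHom (by rw [D.fib.map_id]; rfl)⟩
  comp {x y z} g h := ⟨g.idx ≫ h.idx, g.trans ≫
    Functor.whiskerLeft (D.fib.map g.idx).toFunctor h.trans ≫
      eqToHom (by rw [D.fib.map_comp]; rfl)⟩
  id_comp {x y} g := by
    refine Hom.ext' (Category.id_comp _) ?_
    have e := fib_id D x.idx
    have := trans_id_comp e g.trans (by rw [e]; rfl) (by rw [e]; rfl)
    simpa using this.symm
  comp_id {x y} g := by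
    refine Hom.ext' (Category.comp_id _) ?_
    have e := fib_id D y.idx
    have := trans_comp_id e g.trans (by rw [e]; rfl) (by rw [e]; rfl)
    simpa using this.symm
  assoc {x y z w} g h k := by
    refine Hom.ext' (Category.assoc _ _ _) ?_
    have e₁ := fib_comp D g.idx h.idx
    have e₂ := fib_comp D h.idx k.idx
    have e₃ : (D.fib.map (g.idx ≫ h.idx ≫ k.idx)).toFunctor = (D.fib.map g.idx).toFunctor ⋙
        (D.fib.map h.idx).toFunctor ⋙ (D.fib.map k.idx).toFunctor := by
      rw [fib_comp, fib_comp]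
    have := trans_assoc e₁ e₂ e₃ g.trans h.trans k.trans (by rw [e₁]; rfl) (by rw [e₁, e₃]; rfl)
      (by rw [e₂]; rfl) (by rw [e₂, e₃]; rfl)
    simpa using this.symm

theorem hom_ext {x y : SemiObj D M} {g h : x ⟶ y} (e : Hom.idx g = Hom.idx h)
    (w : ∀ a, (Hom.trans h).app a = (Hom.trans g).app a ≫ eqToHom (by rw [e])) : g = h := by
  refine Hom.ext' e ?_
  ext a
  rw [w]
  simp

@[simp] theorem id_idx (x : SemiObj D M) : Hom.idx (𝟙 x) = 𝟙 x.idx := rfl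

@[simp] theorem comp_idx {x y z : SemiObj D M} (g : x ⟶ y) (h : y ⟶ z) :
    Hom.idx (g ≫ h) = Hom.idx g ≫ Hom.idx h := rfl

theorem id_trans_app (x : SemiObj D M) (a : D.fib.obj x.idx) :
    (Hom.trans (𝟙 x)).app a = eqToHom (by rw [id_idx, fib_id]; rfl) := by
  exact eqToHom_app (by rw [id_idx, fib_id]; rfl) a

theorem comp_trans_app {x y z : SemiObj D M} (g : x ⟶ y) (h : y ⟶ z) (a : D.fib.obj x.idx) :
    (Hom.trans (g ≫ h)).app a = (Hom.trans g).app a ≫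
      (Hom.trans h).app ((D.fib.map (Hom.idx g)).toFunctor.obj a) ≫
        eqToHom (by rw [comp_idx, fib_comp]; rfl) := by
  refine Eq.trans (NatTrans.comp_app g.trans (Functor.whiskerLeft (D.fib.map g.idx).toFunctor
    h.trans ≫ eqToHom (by rw [comp_idx, fib_comp]; rfl)) a) ?_
  simp [eqToHom_app]

theorem trans_app_congr {x y : SemiObj D M} {g h : x ⟶ y} (e : g = h) (a : D.fib.obj x.idx) :
    (Hom.trans g).app a = (Hom.trans h).app a ≫ eqToHom (by rw [e]) := by
  subst e
  simp

theorem eqToHom_idx {x y : SemiObj D M} (e : x = y) :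
    Hom.idx (eqToHom e) = eqToHom (congrArg SemiObj.idx e) := by
  subst e
  rfl

theorem eqToHom_trans_app {x y : SemiObj D M} (e : x = y) (a : D.fib.obj x.idx) :
    (Hom.trans (eqToHom e)).app a = eqToHom (by subst e; rw [eqToHom_refl, id_idx, fib_id]; rfl) := by
  subst e
  exact id_trans_app _ _

/-- The projection `{d, ψ} ↦ d`. -/
abbrev proj (D : CatDiagram.{u}) (M : Type (u + 1)) [Category.{u} M] : SemiObj D M ⥤ D.base where
  obj x := x.idx
  map g := Hom.idx g

/-- The functor `R ⋉ R'`, sending `{d, ψ}` to the category with objects the pairs `a ∈ R d`,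
`b ∈ R' (ψ a)`, that is, to the Grothendieck construction of `ψ ⋙ R'`. -/
abbrev total (D : CatDiagram.{u}) (R : M ⥤ Cat.{0, u}) : SemiObj D M ⥤ Cat.{0, u} where
  obj x := Cat.of (Grothendieck (x.diag ⋙ R))
  map {x y} g := (totalMap (D.fib.map (Hom.idx g)).toFunctor
    (Functor.whiskerRight (Hom.trans g) R)).toCatHom
  map_id x := by
    ext : 1
    refine Eq.trans (Eq.symm ?_) (totalMap_id (x.diag ⋙ R))
    refine totalMap_congr (fib_id D x.idx).symm fun a => ?_
    simp [id_trans_app, eqToHom_map]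
  map_comp {x y z} g h := by
    ext : 1
    refine Eq.trans (Eq.symm ?_) (totalMap_comp _ _ _ _).symm
    refine totalMap_congr (fib_comp D _ _).symm fun a => ?_
    simp [comp_trans_app, eqToHom_map]

end SemiObj

namespace CatDiagram

/-- The semi-direct product `D ⋉ E`. -/
abbrev semi (D E : CatDiagram.{u}) : CatDiagram.{u} where
  base := SemiObj D E.base
  fib := SemiObj.total D E.fib

theorem trans_nat {D E : CatDiagram.{u}} (m : D ⟶ E) {x y : D.base} (f : x ⟶ y) :
    (E.fib.map (m.functor.map f)).toFunctor ⋙ (m.trans.app y).toFunctor =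
      (m.trans.app x).toFunctor ⋙ (D.fib.map f).toFunctor :=
  congrArg Cat.Hom.toFunctor (m.trans.naturality f)

theorem trans_nat_obj {D E : CatDiagram.{u}} (m : D ⟶ E) {x y : D.base} (f : x ⟶ y)
    (a : E.fib.obj (m.functor.obj x)) :
    (m.trans.app y).toFunctor.obj ((E.fib.map (m.functor.map f)).toFunctor.obj a) =
      (D.fib.map f).toFunctor.obj ((m.trans.app x).toFunctor.obj a) :=
  Functor.congr_obj (trans_nat m f) a

/-- The functor of base categories underlying `m ⋉ n`. -/
abbrev semiMapFunctor {D D' E E' : CatDiagram.{u}} (m : D ⟶ E) (n : D' ⟶ E') :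
    SemiObj D D'.base ⥤ SemiObj E E'.base where
  obj x := ⟨m.functor.obj x.idx, (m.trans.app x.idx).toFunctor ⋙ x.diag ⋙ n.functor⟩
  map {x y} g := ⟨m.functor.map g.idx,
    Functor.whiskerLeft (m.trans.app x.idx).toFunctor (Functor.whiskerRight g.trans n.functor) ≫
      eqToHom (congrArg (· ⋙ y.diag ⋙ n.functor) (trans_nat m g.idx).symm)⟩
  map_id x := by
    refine SemiObj.hom_ext (m.functor.map_id _) fun a => ?_
    simp [SemiObj.id_trans_app, eqToHom_map, eqToHom_app]
  map_comp {x y z} g h := by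
    refine SemiObj.hom_ext (m.functor.map_comp _ _) fun a => ?_
    simp [SemiObj.comp_trans_app, eqToHom_map, eqToHom_app]
    rw [app_congr h.trans (trans_nat_obj m g.idx a)]
    simp [eqToHom_map]


theorem app_fib_nat {D E : CatDiagram.{u}} (n : D ⟶ E) {x y : D.base} (f : x ⟶ y) :
    E.fib.map (n.functor.map f) ≫ n.trans.app y = n.trans.app x ≫ D.fib.map f :=
  n.trans.naturality f

/-- Functoriality of the semi-direct product: `m ⋉ n`. -/
def semiMap {D D' E E' : CatDiagram.{u}} (m : D ⟶ E) (n : D' ⟶ E') : semi D D' ⟶ semi E E' where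
  functor := semiMapFunctor m n
  trans :=
    { app x := (totalMap (m.trans.app x.idx).toFunctor (Functor.whiskerLeft
          ((m.trans.app x.idx).toFunctor ⋙ x.diag) n.trans :
            ((m.trans.app x.idx).toFunctor ⋙ x.diag ⋙ n.functor) ⋙ E'.fib ⟶
              (m.trans.app x.idx).toFunctor ⋙ x.diag ⋙ D'.fib)).toCatHom
      naturality x y g := by
        apply Cat.Hom.ext
        refine Eq.trans (totalMap_comp _ _ _ _) (Eq.trans ?_ (totalMap_comp _ _ _ _).symm)
        refine totalMap_congr (trans_nat m g.idx) fun a => ?_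
        have e := trans_nat_obj m g.idx a
        have := app_fib_nat n (g.trans.app ((m.trans.app x.idx).toFunctor.obj a))
        change n.trans.app _ ≫ D'.fib.map _ = (E'.fib.map ((Functor.whiskerLeft
          (m.trans.app x.idx).toFunctor (Functor.whiskerRight g.trans n.functor) ≫
            eqToHom (congrArg (· ⋙ y.diag ⋙ n.functor) (trans_nat m g.idx).symm)).app a) ≫
              n.trans.app (y.diag.obj ((m.trans.app y.idx).toFunctor.obj
                ((E.fib.map (m.functor.map g.idx)).toFunctor.obj a)))) ≫ eqToHom _
        rw [app_congr n.trans (congrArg y.diag.obj e)]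
        refine Eq.trans this.symm ?_
        simp [eqToHom_map, eqToHom_app] }

/-- A diagram `ψ` of diagrams in `M`, each indexed by a category of the form `R d`, is the same as
a diagram in `M` indexed by pairs `a`, `b ∈ R (ψ a).idx`. -/
abbrev flat {A : Type u} [Category.{0} A] {D : CatDiagram.{u}} {M : Type (u + 1)} [Category.{u} M]
    (ψ : A ⥤ SemiObj D M) : Grothendieck ((ψ ⋙ SemiObj.proj D M) ⋙ D.fib) ⥤ M where
  obj p := (ψ.obj p.base).diag.obj p.fiber
  map {p q} f := (SemiObj.Hom.trans (ψ.map f.base)).app p.fiber ≫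
    (ψ.obj q.base).diag.map f.fiber
  map_id p := by
    have e : (D.fib.map (SemiObj.Hom.idx (ψ.map (𝟙 p.base)))).toFunctor.obj p.fiber = p.fiber := by
      rw [ψ.map_id, SemiObj.id_idx, SemiObj.fib_id]; rfl
    change (SemiObj.Hom.trans (ψ.map (𝟙 p.base))).app p.fiber ≫
      (ψ.obj p.base).diag.map (eqToHom e) = 𝟙 ((ψ.obj p.base).diag.obj p.fiber)
    rw [SemiObj.trans_app_congr (ψ.map_id p.base), SemiObj.id_trans_app, eqToHom_map]
    simp
  map_comp {p q r} f g := by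
    have e : (D.fib.map (SemiObj.Hom.idx (ψ.map (f.base ≫ g.base)))).toFunctor.obj p.fiber =
        (D.fib.map (SemiObj.Hom.idx (ψ.map g.base))).toFunctor.obj
          ((D.fib.map (SemiObj.Hom.idx (ψ.map f.base))).toFunctor.obj p.fiber) := by
      rw [ψ.map_comp, SemiObj.comp_idx, SemiObj.fib_comp]; rfl
    change (SemiObj.Hom.trans (ψ.map (f.base ≫ g.base))).app p.fiber ≫
      (ψ.obj r.base).diag.map (eqToHom e ≫
        (D.fib.map (SemiObj.Hom.idx (ψ.map g.base))).toFunctor.map f.fiber ≫ g.fiber) = _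
    rw [SemiObj.trans_app_congr (ψ.map_comp f.base g.base), SemiObj.comp_trans_app]
    have := (SemiObj.Hom.trans (ψ.map g.base)).naturality f.fiber
    dsimp at this ⊢
    simp [reassoc_of% this, eqToHom_map]

/-- The action of `flat` on natural transformations. -/
def flatMap {A B : Type u} [Category.{0} A] [Category.{0} B] {D : CatDiagram.{u}}
    {M : Type (u + 1)} [Category.{u} M] {ψ : A ⥤ SemiObj D M} {ψ' : B ⥤ SemiObj D M}
    (G : A ⥤ B) (φ : ψ ⟶ G ⋙ ψ') :
    flat ψ ⟶ totalMap (P := (ψ ⋙ SemiObj.proj D M) ⋙ D.fib) (Q := (ψ' ⋙ SemiObj.proj D M) ⋙ D.fib) G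
      (Functor.whiskerRight (Functor.whiskerRight φ (SemiObj.proj D M)) D.fib) ⋙ flat ψ' where
  app p := (SemiObj.Hom.trans (φ.app p.base)).app p.fiber
  naturality p q f := by
    have e : (D.fib.map (SemiObj.Hom.idx (ψ'.map (G.map f.base)))).toFunctor.obj
          ((D.fib.map (SemiObj.Hom.idx (φ.app p.base))).toFunctor.obj p.fiber) =
        (D.fib.map (SemiObj.Hom.idx (φ.app q.base))).toFunctor.obj
          ((D.fib.map (SemiObj.Hom.idx (ψ.map f.base))).toFunctor.obj p.fiber) := by
      have := congrArg (fun t => (D.fib.map (SemiObj.Hom.idx t)).toFunctor.obj p.fiber)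
        (φ.naturality f.base)
      simp only [SemiObj.comp_idx, SemiObj.fib_comp] at this
      exact this.symm
    have l := SemiObj.trans_app_congr (φ.naturality f.base) p.fiber
    rw [SemiObj.comp_trans_app, SemiObj.comp_trans_app] at l
    have h := (SemiObj.Hom.trans (φ.app q.base)).naturality f.fiber
    change ((SemiObj.Hom.trans (ψ.map f.base)).app p.fiber ≫ (ψ.obj q.base).diag.map f.fiber) ≫
        (SemiObj.Hom.trans (φ.app q.base)).app q.fiber =
      (SemiObj.Hom.trans (φ.app p.base)).app p.fiber ≫
        (SemiObj.Hom.trans (ψ'.map (G.map f.base))).app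
          ((D.fib.map (SemiObj.Hom.idx (φ.app p.base))).toFunctor.obj p.fiber) ≫
        (ψ'.obj (G.obj q.base)).diag.map (eqToHom e ≫
          (D.fib.map (SemiObj.Hom.idx (φ.app q.base))).toFunctor.map f.fiber)
    dsimp at l h ⊢
    rw [← Category.assoc, comp_eqToHom_iff] at l
    rw [Category.assoc, h, Functor.map_comp, eqToHom_map, reassoc_of% l]
    simp

/-- The functor of base categories underlying the associator. -/
abbrev assocFunctor (D D' : CatDiagram.{u}) (M : Type (u + 1)) [Category.{u} M] :
    SemiObj D (SemiObj D' M) ⥤ SemiObj (semi D D') M where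
  obj x := ⟨⟨x.idx, x.diag ⋙ SemiObj.proj D' M⟩, flat x.diag⟩
  map {x y} g := ⟨⟨g.idx, Functor.whiskerRight g.trans (SemiObj.proj D' M)⟩,
    flatMap (D.fib.map g.idx).toFunctor g.trans⟩
  map_id x := by
    refine SemiObj.hom_ext (SemiObj.hom_ext rfl fun a => ?_) fun p => ?_
    · simp [SemiObj.id_trans_app, SemiObj.eqToHom_idx]
    · rw [SemiObj.id_trans_app]
      change _ = (SemiObj.Hom.trans ((SemiObj.Hom.trans (𝟙 x)).app p.base)).app p.fiber ≫ _
      rw [SemiObj.trans_app_congr (SemiObj.id_trans_app x p.base), SemiObj.eqToHom_trans_app]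
      simp
  map_comp g h := by
    refine SemiObj.hom_ext (SemiObj.hom_ext rfl fun a => ?_) fun p => ?_
    · simp [SemiObj.comp_trans_app, SemiObj.eqToHom_idx]
    · rw [SemiObj.comp_trans_app]
      change (SemiObj.Hom.trans ((SemiObj.Hom.trans g).app p.base)).app p.fiber ≫
        (SemiObj.Hom.trans ((SemiObj.Hom.trans h).app
          ((D.fib.map (SemiObj.Hom.idx g)).toFunctor.obj p.base))).app
            ((D'.fib.map (SemiObj.Hom.idx ((SemiObj.Hom.trans g).app p.base))).toFunctor.obj
              p.fiber) ≫ _ =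
        (SemiObj.Hom.trans ((SemiObj.Hom.trans (g ≫ h)).app p.base)).app p.fiber ≫ _
      rw [SemiObj.trans_app_congr (SemiObj.comp_trans_app g h p.base),
        SemiObj.comp_trans_app ((SemiObj.Hom.trans g).app p.base),
        SemiObj.comp_trans_app ((SemiObj.Hom.trans h).app _), SemiObj.eqToHom_trans_app]
      simp

theorem total_aux {C₁ C₂ C₃ : Type*} [Category* C₁] [Category* C₂] [Category* C₃] (T : C₁ ⥤ C₂)
    (d : C₂ ⥤ C₃) (K : C₁ ⥤ C₃) (hK : K = T ⋙ d) {w x y : C₁} {v : C₂} {z : C₃} (f : x ⟶ y)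
    (g : K.obj y ⟶ z) (e₁ : v = T.obj w) (e₂ : w = x) (e₃ : d.obj (T.obj y) = K.obj y) :
    HEq (K.map f ≫ g)
      (d.map (eqToHom e₁ ≫ T.map (eqToHom e₂ ≫ f)) ≫ eqToHom e₃ ≫ g) := by
  subst hK e₁ e₂
  simp

theorem total_aux' {C₁ C₂ : Type*} [Category* C₁] [Category* C₂] (T : C₁ ⥤ C₂)
    {w x y : C₁} (f : x ⟶ y) (e : w = x) :
    HEq (T.map f) (T.map (eqToHom e ≫ f)) := by
  subst e
  simp

/-- The regrouping of triples, `((a, b), c) ↦ (a, (b, c))`. -/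
def totalAssoc {A : Type u} [Category.{0} A] {D : CatDiagram.{u}} {M : Type (u + 1)}
    [Category.{u} M] (ψ : A ⥤ SemiObj D M) (R : M ⥤ Cat.{0, u}) :
    Grothendieck (flat ψ ⋙ R) ⥤ Grothendieck (ψ ⋙ SemiObj.total D R) where
  obj p := ⟨p.base.base, ⟨p.base.fiber, p.fiber⟩⟩
  map {p q} f := ⟨f.base.base, ⟨f.base.fiber, eqToHom (Functor.congr_obj (congrArg Cat.Hom.toFunctor
    (R.map_comp ((SemiObj.Hom.trans (ψ.map f.base.base)).app p.base.fiber)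
      ((ψ.obj q.base.base).diag.map f.base.fiber))).symm p.fiber) ≫ f.fiber⟩⟩
  map_id p := by
    apply eq_of_heq
    refine total_hext rfl rfl HEq.rfl ?_
    have e : ((SemiObj.total D R).map (ψ.map (𝟙 p.base.base))).toFunctor.obj
        (Grothendieck.mk p.base.fiber p.fiber) = Grothendieck.mk p.base.fiber p.fiber := by
      rw [ψ.map_id, (SemiObj.total D R).map_id]
      rfl
    refine HEq.trans ?_ (eqToHom_heq_id_cod _ _ e).symm
    refine total_hext e rfl ?_ ?_
    · exact (eqToHom_heq_id_cod _ _ (congrArg Grothendieck.base e))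
    · refine (eqToHom_comp_heq _ _).trans ?_
      exact (eqToHom_heq_id_cod _ _ (Functor.congr_obj (congrArg Cat.Hom.toFunctor
        ((flat ψ ⋙ R).map_id p.base)) p.fiber)).trans (eqToHom_heq_id_cod _ _ (Functor.congr_obj
          (congrArg Cat.Hom.toFunctor (((ψ.obj p.base.base).diag ⋙ R).map_id p.base.fiber))
            p.fiber)).symm
  map_comp {p q r} f g := by
    apply eq_of_heq
    refine total_hext rfl rfl HEq.rfl ?_
    refine HEq.trans ?_ (eqToHom_comp_heq _ _).symm
    have e := Functor.congr_obj (congrArg Cat.Hom.toFunctor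
      ((ψ ⋙ SemiObj.total D R).map_comp f.base.base g.base.base))
        (Grothendieck.mk p.base.fiber p.fiber)
    refine total_hext e rfl (eqToHom_comp_heq _ _) ?_
    refine (eqToHom_comp_heq _ _).trans ((eqToHom_comp_heq _ _).trans ?_)
    refine HEq.trans ?_ (eqToHom_comp_heq _ _).symm
    exact total_aux _ _ _ (congrArg Cat.Hom.toFunctor (R.map_comp _ _)) _ _ _ _ _

/-- The associator of the semi-direct product. -/
def assoc (D D' D'' : CatDiagram.{u}) : semi D (semi D' D'') ⟶ semi (semi D D') D'' where
  functor := assocFunctor D D' D''.base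
  trans :=
    { app x := (totalAssoc x.diag D''.fib).toCatHom
      naturality x y g := by
        apply Cat.Hom.ext
        change (totalMap (Q := flat y.diag ⋙ D''.fib) (totalMap (Q := (y.diag ⋙ SemiObj.proj D' D''.base) ⋙ D'.fib) (D.fib.map (SemiObj.Hom.idx g)).toFunctor (Functor.whiskerRight
          (Functor.whiskerRight (SemiObj.Hom.trans g) (SemiObj.proj D' D''.base)) D'.fib))
            (Functor.whiskerRight (flatMap (D.fib.map (SemiObj.Hom.idx g)).toFunctor
              (SemiObj.Hom.trans g)) D''.fib)) ⋙ totalAssoc y.diag D''.fib =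
            totalAssoc x.diag D''.fib ⋙ totalMap (Q := y.diag ⋙ SemiObj.total D' D''.fib) (D.fib.map (SemiObj.Hom.idx g)).toFunctor
              (Functor.whiskerRight (SemiObj.Hom.trans g) (SemiObj.total D' D''.fib))
        refine Functor.hext (fun p => ?_) fun p q f => ?_
        · rfl
        · refine total_hext rfl rfl HEq.rfl ?_
          refine HEq.trans ?_ (eqToHom_comp_heq _ _).symm
          have e := nat_obj (P := x.diag ⋙ SemiObj.total D' D''.fib)
            (Q := y.diag ⋙ SemiObj.total D' D''.fib) (G := (D.fib.map (SemiObj.Hom.idx g)).toFunctor)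
            (Functor.whiskerRight (SemiObj.Hom.trans g) (SemiObj.total D' D''.fib)) f.base.base
            (Grothendieck.mk p.base.fiber p.fiber)
          refine total_hext e rfl ?_ ?_
          · exact eqToHom_comp_heq _ _
          · refine (eqToHom_comp_heq _ _).trans ((eqToHom_comp_heq _ _).trans ?_)
            refine HEq.trans ?_ (eqToHom_comp_heq _ _).symm
            exact total_aux' _ _ _ }


end CatDiagram

/-! ### The unit diagram -/

/-- The one-object discrete category, as a small category. -/
inductive Pt : Type u
  | pt

instance : Category.{0} Pt.{u} where
  Hom _ _ := PUnit
  id _ := ⟨⟩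
  comp _ _ := ⟨⟩

namespace CatDiagram

/-- The one-object discrete category, as a base category. -/
inductive PtIdx : Type (u + 1)
  | pt

instance : Category.{u} PtIdx.{u} where
  Hom _ _ := PUnit
  id _ := ⟨⟩
  comp _ _ := ⟨⟩

/-- The unit diagram `𝟏`: the one-object category, mapped to itself. -/
abbrev one : CatDiagram.{u} where
  base := PtIdx.{u}
  fib := (Functor.const _).obj (Cat.of Pt.{u})

/-- The functor to the one-object category. -/
abbrev toPt (A : Type u) [Category.{0} A] : A ⥤ Pt.{u} where
  obj _ := .pt
  map _ := ⟨⟩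

theorem unit_aux {C : Type*} [Category* C] (K : C ⥤ C) (hK : K = 𝟭 C) {x y z w : C}
    (f : x ⟶ y) (g : K.obj y ⟶ z) (e : w = x) (e' : y = K.obj y) :
    HEq (K.map f ≫ g) ((eqToHom e ≫ f) ≫ eqToHom e' ≫ g) := by
  subst hK e
  simp

/-- For a constant diagram on the one-object category, the pairs are the objects of the fibre. -/
abbrev constFiber (X : CatDiagram.{u}) (x : X.base) :
    Grothendieck ((Functor.const Pt.{u}).obj x ⋙ X.fib) ⥤ X.fib.obj x where
  obj p := p.fiber
  map {p q} f := eqToHom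
    (Functor.congr_obj (congrArg Cat.Hom.toFunctor (X.fib.map_id x)) p.fiber).symm ≫ f.fiber
  map_id p := by
    apply eq_of_heq
    refine (eqToHom_comp_heq _ _).trans ?_
    exact eqToHom_heq_id_cod _ _
      (Functor.congr_obj (congrArg Cat.Hom.toFunctor (X.fib.map_id x)) p.fiber)
  map_comp {p q r} f g := by
    apply eq_of_heq
    refine (eqToHom_comp_heq _ _).trans ((eqToHom_comp_heq _ _).trans ?_)
    exact unit_aux _ (congrArg Cat.Hom.toFunctor (X.fib.map_id x)) _ _ _ _

/-- The inverse of the left unitor, `X ⟶ 𝟏 ⋉ X`. -/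
def leftUnitorInv (X : CatDiagram.{u}) : X ⟶ semi one X where
  functor :=
    { obj x := ⟨.pt, (Functor.const _).obj x⟩
      map {x y} f := ⟨⟨⟩,
        { app _ := f
          naturality _ _ _ := (Category.id_comp f).trans (Category.comp_id f).symm }⟩
      map_id x := SemiObj.hom_ext rfl fun a => by
        rw [SemiObj.id_trans_app]; exact (Category.id_comp _).symm
      map_comp f g := SemiObj.hom_ext rfl fun a => by
        rw [SemiObj.comp_trans_app]; exact (Category.assoc _ _ _).symm }
  trans :=
    { app x := (constFiber X x).toCatHom
      naturality x y f := by
        apply Cat.Hom.ext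
        refine Functor.hext (fun p => rfl) fun p q g => ?_
        refine (eqToHom_comp_heq _ _).trans ((eqToHom_comp_heq _ _).trans ?_)
        exact total_aux' _ _ _ }

/-- The right unitor `D ⋉ 𝟏 ⟶ D`. -/
def rightUnitor (D : CatDiagram.{u}) : semi D one ⟶ D where
  functor := SemiObj.proj D _
  trans :=
    { app x := Functor.toCatHom
        { obj a := Grothendieck.mk a Pt.pt
          map α := Grothendieck.Hom.mk α PUnit.unit }
      naturality x y g := by
        apply Cat.Hom.ext
        refine Functor.hext (fun p => rfl) fun p q g => ?_
        rfl }

end CatDiagram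

/-! ### The diagram of simplicial sets and its multiplication -/

open CatDiagram

/-- The diagram `SSet`: a simplicial set is sent to its category of elements, with objects the
simplices and with morphisms the simplicial operators that send one simplex to another. -/
abbrev sSetDiagram : CatDiagram.{u} where
  base := SSet.{u}
  fib := Functor.elementsFunctor

theorem diag_mk_eq (x : SemiObj sSetDiagram.{u} SSet.{u}) {n m : SimplexCategoryᵒᵖ} (θ : n ⟶ m)
    (s : x.idx.obj n) {t : x.idx.obj m} (e : x.idx.map θ s = t) (y : (x.diag.obj ⟨n, s⟩).obj n) :
    (⟨x.idx.map θ s,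
      (x.diag.map (CategoryOfElements.homMk ⟨n, s⟩ ⟨m, x.idx.map θ s⟩ θ rfl)).app m
        ((x.diag.obj ⟨n, s⟩).map θ y)⟩ : Σ s : x.idx.obj m, (x.diag.obj ⟨m, s⟩).obj m) =
    ⟨t, (x.diag.map (CategoryOfElements.homMk ⟨n, s⟩ ⟨m, t⟩ θ e)).app m
        ((x.diag.obj ⟨n, s⟩).map θ y)⟩ := by
  subst e
  rfl

theorem diag_map_comp_aux {F : SSet.{u}} {ψ : F.Elements ⥤ SSet.{u}} {a b c : F.Elements}
    (f : a ⟶ b) (g : b ⟶ c) {n : SimplexCategoryᵒᵖ} (y : (ψ.obj a).obj n) :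
    (ψ.map (f ≫ g)).app n y = (ψ.map g).app n ((ψ.map f).app n y) := by
  rw [ψ.map_comp]
  rfl

/-- The diagonal `Δ(S, ψ)` of the bisimplicial set of a pair `{S, ψ}`: its `n`-simplices are the pairs
of an `n`-simplex `s` of `S` and an `n`-simplex of `ψ s`. -/
abbrev diagObj (x : SemiObj sSetDiagram.{u} SSet.{u}) : SSet.{u} where
  obj n := Σ s : x.idx.obj n, (x.diag.obj ⟨n, s⟩).obj n
  map {n m} θ := TypeCat.ofHom fun p => ⟨x.idx.map θ p.1,
    (x.diag.map (CategoryOfElements.homMk ⟨n, p.1⟩ ⟨m, x.idx.map θ p.1⟩ θ rfl)).app m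
      ((x.diag.obj ⟨n, p.1⟩).map θ p.2)⟩
  map_id n := by
    refine ConcreteCategory.hom_ext _ _ fun p => ?_
    obtain ⟨s, y⟩ := p
    refine (diag_mk_eq x (𝟙 n) s (t := s) (by simp) y).trans ?_
    refine Sigma.ext rfl (heq_of_eq ?_)
    have h := ConcreteCategory.congr_hom (congrArg (fun t => NatTrans.app t n)
      (x.diag.map_id ⟨n, s⟩)) ((x.diag.obj ⟨n, s⟩).map (𝟙 n) y)
    refine Eq.trans h ?_
    exact ConcreteCategory.congr_hom ((x.diag.obj ⟨n, s⟩).map_id n) y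
  map_comp {n m k} f g := by
    refine ConcreteCategory.hom_ext _ _ fun p => ?_
    obtain ⟨s, y⟩ := p
    refine (diag_mk_eq x (f ≫ g) s (t := x.idx.map g (x.idx.map f s)) (by simp) y).trans ?_
    refine Sigma.ext rfl (heq_of_eq ?_)
    have h := diag_map_comp_aux (ψ := x.diag)
      (CategoryOfElements.homMk (F := x.idx) ⟨n, s⟩ ⟨m, x.idx.map f s⟩ f rfl)
      (CategoryOfElements.homMk (F := x.idx) ⟨m, x.idx.map f s⟩
        ⟨k, x.idx.map g (x.idx.map f s)⟩ g rfl)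
      ((x.diag.obj ⟨n, s⟩).map (f ≫ g) y)
    refine Eq.trans h (congrArg _ ?_)
    have h' := ConcreteCategory.congr_hom ((x.diag.map
      (CategoryOfElements.homMk (F := x.idx) ⟨n, s⟩ ⟨m, x.idx.map f s⟩ f rfl)).naturality g)
        ((x.diag.obj ⟨n, s⟩).map f y)
    rw [(x.diag.obj ⟨n, s⟩).map_comp]
    exact h'

/-- The diagonal as a functor. -/
abbrev diagFunctor : SemiObj sSetDiagram.{u} SSet.{u} ⥤ SSet.{u} where
  obj := diagObj
  map {x y} g :=
    { app n := TypeCat.ofHom fun p =>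
        ⟨g.idx.app n p.1, (g.trans.app ⟨n, p.1⟩).app n p.2⟩
      naturality n m θ := by
        refine ConcreteCategory.hom_ext _ _ fun p => ?_
        obtain ⟨s, z⟩ := p
        have e : y.idx.map θ (g.idx.app n s) = g.idx.app m (x.idx.map θ s) :=
          (ConcreteCategory.congr_hom (g.idx.naturality θ) s).symm
        refine Eq.trans ?_ (diag_mk_eq y θ (g.idx.app n s) e _).symm
        have h := ConcreteCategory.congr_hom (congrArg (fun t => t.app m) (g.trans.naturality
          (CategoryOfElements.homMk (F := x.idx) ⟨n, s⟩ ⟨m, x.idx.map θ s⟩ θ rfl)))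
            ((x.diag.obj ⟨n, s⟩).map θ z)
        have h' := ConcreteCategory.congr_hom ((g.trans.app ⟨n, s⟩).naturality θ) z
        refine Sigma.ext rfl (heq_of_eq ?_)
        refine Eq.trans h ?_
        exact congrArg (fun w => (y.diag.map (CategoryOfElements.homMk (F := y.idx)
          ⟨n, g.idx.app n s⟩ ⟨m, g.idx.app m (x.idx.map θ s)⟩ θ e)).app m w) h' }
  map_id x := by
    refine NatTrans.ext (funext fun n => ConcreteCategory.hom_ext _ _ fun p => ?_)
    refine Sigma.ext rfl (heq_of_eq ?_)
    have e := ConcreteCategory.congr_hom (congrArg (fun t => NatTrans.app t n)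
      (SemiObj.id_trans_app x ⟨n, p.1⟩)) p.2
    exact e
  map_comp {x y z} g h := by
    refine NatTrans.ext (funext fun n => ConcreteCategory.hom_ext _ _ fun p => ?_)
    refine Sigma.ext rfl (heq_of_eq ?_)
    have e := ConcreteCategory.congr_hom (congrArg (fun t => NatTrans.app t n)
      (SemiObj.comp_trans_app g h ⟨n, p.1⟩)) p.2
    exact e

theorem diag_hom_snd {x : SemiObj sSetDiagram.{u} SSet.{u}} {n m : SimplexCategoryᵒᵖ} (θ : n ⟶ m)
    (p : (diagObj x).obj n) (q : (diagObj x).obj m) (e : (diagObj x).map θ p = q)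
    (e₁ : x.idx.map θ p.1 = q.1) :
    (x.diag.obj ⟨m, q.1⟩).map θ ((x.diag.map (CategoryOfElements.homMk (F := x.idx) ⟨n, p.1⟩
      ⟨m, q.1⟩ θ e₁)).app n p.2) = q.2 := by
  subst e
  exact (ConcreteCategory.congr_hom ((x.diag.map (CategoryOfElements.homMk (F := x.idx)
    ⟨n, p.1⟩ ⟨m, x.idx.map θ p.1⟩ θ rfl)).naturality θ) p.2).symm

theorem elements_hext {F : SSet.{u}} {n : SimplexCategoryᵒᵖ} {s s' : F.obj n} {b : F.Elements}
    (e : s = s') (f : @Quiver.Hom F.Elements _ ⟨n, s⟩ b)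
    (g : @Quiver.Hom F.Elements _ ⟨n, s'⟩ b)
    (h : f.1 = g.1) : HEq f g := by
  subst e
  exact heq_of_eq (CategoryOfElements.ext _ _ _ h)

theorem elements_eqToHom {F : SSet.{u}} {n : SimplexCategoryᵒᵖ} {s s' : F.obj n}
    (e : (⟨n, s⟩ : F.Elements) = ⟨n, s'⟩) : (eqToHom (C := F.Elements) e).1 = 𝟙 n := by
  obtain rfl : s = s' := by simpa using e
  rfl

/-- The multiplication of the diagram `SSet`: the diagonal, with the diagonal functor
`(n, (s, y)) ↦ ((n, s), (n, y))` from its category of elements. -/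
def sSetMul : semi sSetDiagram sSetDiagram ⟶ sSetDiagram.{u} where
  functor := diagFunctor
  trans :=
    { app x := Functor.toCatHom
        { obj t := Grothendieck.mk ⟨t.1, t.2.1⟩ ⟨t.1, t.2.2⟩
          map {t t'} θ := ⟨⟨θ.1, congrArg Sigma.fst θ.2⟩, ⟨θ.1,
            diag_hom_snd θ.1 t.2 t'.2 θ.2 (congrArg Sigma.fst θ.2)⟩⟩
          map_id t := by
            apply eq_of_heq
            refine total_hext rfl rfl HEq.rfl ?_
            have e : (x.diag.map (CategoryStruct.id (obj := x.idx.Elements) ⟨t.1, t.2.1⟩)).app t.1 t.2.2 = t.2.2 :=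
              ConcreteCategory.congr_hom (congrArg (fun t => NatTrans.app t _)
                (x.diag.map_id ⟨t.1, t.2.1⟩)) t.2.2
            refine elements_hext rfl _ _ ?_
            exact (elements_eqToHom (F := x.diag.obj ⟨t.1, t.2.1⟩) (congrArg (Sigma.mk t.1) e)).symm
          map_comp {p q r} f g := by
            apply eq_of_heq
            refine total_hext rfl rfl HEq.rfl ?_
            refine HEq.trans ?_ (eqToHom_comp_heq _ _).symm
            refine elements_hext ?_ _ _ rfl
            exact diag_map_comp_aux (ψ := x.diag)
              (CategoryOfElements.homMk (F := x.idx) ⟨p.1, p.2.1⟩ ⟨q.1, q.2.1⟩ f.1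
                (congrArg Sigma.fst f.2))
              (CategoryOfElements.homMk (F := x.idx) ⟨q.1, q.2.1⟩ ⟨r.1, r.2.1⟩ g.1
                (congrArg Sigma.fst g.2)) p.2.2 }
      naturality x y g := by
        apply Cat.Hom.ext
        refine Functor.hext (fun p => rfl) fun p q f => ?_
        refine total_hext rfl rfl HEq.rfl ?_
        refine HEq.trans ?_ (eqToHom_comp_heq _ _).symm
        refine elements_hext ?_ _ _ rfl
        exact (ConcreteCategory.congr_hom (congrArg (fun t => NatTrans.app t p.1)
          (g.trans.naturality (CategoryOfElements.homMk (F := x.idx)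
            ⟨p.1, p.2.1⟩ ⟨q.1, q.2.1⟩ f.1 (congrArg Sigma.fst f.2)))) p.2.2).symm }

/-- The unit of the diagram `SSet`: the one-point simplicial set. -/
def sSetUnit : one ⟶ sSetDiagram.{u} where
  functor := (Functor.const _).obj ((Functor.const _).obj PUnit)
  trans :=
    { app _ := Functor.toCatHom (toPt _) }

/-! ### Subcategories -/

/-- A (not necessarily full) subcategory of `C`. -/
structure Subcat (C : Type*) [Category* C] where
  obj : C → Prop
  hom : ∀ ⦃x y : C⦄, (x ⟶ y) → Prop
  id_mem : ∀ x, obj x → hom (𝟙 x)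
  comp_mem : ∀ ⦃x y z : C⦄ (f : x ⟶ y) (g : y ⟶ z), obj x → obj y → obj z →
    hom f → hom g → hom (f ≫ g)

namespace Subcat

theorem eqToHom_mem {C : Type*} [Category* C] (S : Subcat C) {x y : C} (e : x = y)
    (h : S.obj x) : S.hom (eqToHom e) := by
  subst e
  exact S.id_mem x h

/-- The objects of a subcategory. -/
structure Carrier {C : Type*} [Category* C] (S : Subcat C) where
  val : C
  mem : S.obj val

instance {C : Type*} [Category* C] (S : Subcat C) : Category S.Carrier where
  Hom x y := {f : x.val ⟶ y.val // S.hom f}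
  id x := ⟨𝟙 _, S.id_mem _ x.mem⟩
  comp {x y z} f g := ⟨f.1 ≫ g.1, S.comp_mem _ _ x.mem y.mem z.mem f.2 g.2⟩

/-- The inclusion functor of a subcategory. -/
abbrev incl {C : Type*} [Category* C] (S : Subcat C) : S.Carrier ⥤ C where
  obj := Carrier.val
  map f := f.1

end Subcat

/-- The restriction of a diagram of categories to a subcategory of its base. -/
abbrev CatDiagram.restrict (D : CatDiagram.{u}) (S : Subcat D.base) : CatDiagram.{u} where
  base := S.Carrier
  fib := S.incl ⋙ D.fib

/-- The inclusion of the restriction. -/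
abbrev CatDiagram.restrictIncl (D : CatDiagram.{u}) (S : Subcat D.base) : D.restrict S ⟶ D where
  functor := S.incl
  trans := 𝟙 _

/-- The semi-direct product of two subcategories: pairs `{d, ψ}` with `d` in the first and `ψ` taking
values in the second subcategory, and morphisms `{f, φ}` with `f` in the first and all components
of `φ` in the second subcategory. -/
def Subcat.semi {D : CatDiagram.{u}} {M : Type (u + 1)} [Category.{u} M] (S : Subcat D.base)
    (T : Subcat M) : Subcat (SemiObj D M) where
  obj x := S.obj x.idx ∧ (∀ a, T.obj (x.diag.obj a)) ∧
    ∀ ⦃a b⦄ (α : a ⟶ b), T.hom (x.diag.map α)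
  hom x y g := S.hom (SemiObj.Hom.idx g) ∧ ∀ a, T.hom ((SemiObj.Hom.trans g).app a)
  id_mem x hx := ⟨S.id_mem _ hx.1, fun a => by
    rw [SemiObj.id_trans_app]
    exact T.eqToHom_mem _ (hx.2.1 a)⟩
  comp_mem x y z f g hx hy hz hf hg := ⟨S.comp_mem _ _ hx.1 hy.1 hz.1 hf.1 hg.1, fun a => by
    rw [SemiObj.comp_trans_app]
    refine T.comp_mem _ _ (hx.2.1 _) (hy.2.1 _) (hz.2.1 _) (hf.2 a) ?_
    refine T.comp_mem _ _ (hy.2.1 _) (hz.2.1 _) (hz.2.1 _) (hg.2 _) ?_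
    exact T.eqToHom_mem _ (hz.2.1 _)⟩

/-! ### Points and fibrations -/

section Fib

variable {M : Type (u + 1)} [Category.{u} M]

/-- The cosimplicial object `n ↦ I[n]`, the constant diagram with value `I` over `Δ[n]`. -/
def pointDiagram (I : M) : SimplexCategory ⥤ SemiObj sSetDiagram.{u} M where
  obj n := ⟨SSet.stdSimplex.obj n, (Functor.const _).obj I⟩
  map θ := ⟨SSet.stdSimplex.map θ, { app _ := 𝟙 I }⟩
  map_id n := by
    refine SemiObj.hom_ext (SSet.stdSimplex.map_id n) fun a => ?_
    rw [SemiObj.id_trans_app]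
    simp
  map_comp f g := by
    refine SemiObj.hom_ext (SSet.stdSimplex.map_comp f g) fun a => ?_
    rw [SemiObj.comp_trans_app]
    simp

/-- The simplicial set of `I`-points, with `n`-simplices the morphisms out of `I[n]`. -/
def iPoints (I : M) : SemiObj sSetDiagram.{u} M ⥤ SSet.{u} :=
  yoneda ⋙ (Functor.whiskeringLeft _ _ _).obj (pointDiagram I).op

/-- Fibrations with respect to a set `𝓘` of generators of `M`: the map of simplicial sets is injective
and the maps on `I`-points are Kan fibrations (right lifting property for the horn inclusions). -/
def IsDiagramFibration (𝓘 : Set M) {x y : SemiObj sSetDiagram.{u} M} (g : x ⟶ y) : Prop :=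
  Mono (C := SSet.{u}) (SemiObj.Hom.idx g) ∧
    ∀ I ∈ 𝓘, SSet.modelCategoryQuillen.J.rlp ((iPoints I).map g)

end Fib

theorem IsDiagramFibration.id {M : Type (u + 1)} [Category.{u} M] (𝓘 : Set M)
    (x : SemiObj sSetDiagram.{u} M) : IsDiagramFibration 𝓘 (𝟙 x) :=
  ⟨inferInstanceAs (Mono (C := SSet.{u}) (𝟙 x.idx)), fun I _ => by
    rw [CategoryTheory.Functor.map_id]
    exact MorphismProperty.id_mem _ _⟩

theorem IsDiagramFibration.comp {M : Type (u + 1)} [Category.{u} M] {𝓘 : Set M}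
    {x y z : SemiObj sSetDiagram.{u} M} {g : x ⟶ y} {h : y ⟶ z} (hg : IsDiagramFibration 𝓘 g)
    (hh : IsDiagramFibration 𝓘 h) : IsDiagramFibration 𝓘 (g ≫ h) :=
  ⟨@mono_comp SSet.{u} _ _ _ _ g.idx hg.1 h.idx hh.1, fun I hI => by
    rw [CategoryTheory.Functor.map_comp]
    exact MorphismProperty.comp_mem _ _ _ (hg.2 I hI) (hh.2 I hI)⟩

/-! ### The sequences of iterated subcategories of fibrations -/

/-- The subcategory of all objects and all morphisms. -/
def Subcat.all (C : Type*) [Category* C] : Subcat C where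
  obj _ := True
  hom _ _ _ := True
  id_mem _ _ := trivial
  comp_mem _ _ _ _ _ _ _ _ _ _ := trivial

/-- The subcategory `sset` of all simplicial sets and injective morphisms. -/
def ssetSubcat : Subcat SSet.{u} where
  obj _ := True
  hom _ _ f := Mono f
  id_mem _ _ := inferInstance
  comp_mem _ _ _ f g _ _ _ hf hg := @mono_comp _ _ _ _ _ f hf g hg

/-- An ambient diagram of categories, a set of generators of its base category and a
subcategory of its base category. -/
structure Stage : Type (u + 2) where
  amb : CatDiagram.{u}
  gen : Set amb.base
  sub : Subcat amb.base

namespace Stage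

/-- The subcategory of a stage, as a diagram of categories. -/
abbrev diagram (S : Stage.{u}) : CatDiagram.{u} := S.amb.restrict S.sub

/-- The inclusion of the subcategory of a stage into the ambient diagram. -/
abbrev incl (S : Stage.{u}) : S.diagram ⟶ S.amb := S.amb.restrictIncl S.sub

/-- `sset ∘ S`: the subcategory of fibrations in `sset ⋉ S`, inside the ambient `SSet ⋉ amb`,
with generators the constant diagrams `I[n]` for generators `I` of `S`. -/
def next (S : Stage.{u}) : Stage.{u} where
  amb := sSetDiagram.semi S.amb
  gen := {x | ∃ I ∈ S.gen, ∃ n : ℕ, x = (pointDiagram I).obj (SimplexCategory.mk n)}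
  sub :=
    { obj := (ssetSubcat.semi (D := sSetDiagram) S.sub).obj
      hom := fun _ _ g => (ssetSubcat.semi (D := sSetDiagram) S.sub).hom g ∧
        IsDiagramFibration S.gen g
      id_mem := fun x hx => ⟨(ssetSubcat.semi (D := sSetDiagram) S.sub).id_mem x hx,
        IsDiagramFibration.id S.gen x⟩
      comp_mem := fun _ _ _ f g hx hy hz hf hg =>
        ⟨(ssetSubcat.semi (D := sSetDiagram) S.sub).comp_mem f g hx hy hz hf.1 hg.1,
          IsDiagramFibration.comp hf.2 hg.2⟩ }

end Stage

/-- `ssetPow k` is the stage of `sset^{∘(k+1)}` inside `SSet^{⋉(k+1)}`. -/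
def ssetPow : ℕ → Stage.{u}
  | 0 => ⟨sSetDiagram, Set.range fun n : ℕ => SSet.stdSimplex.obj (SimplexCategory.mk n),
      ssetSubcat⟩
  | k + 1 => (ssetPow k).next

/-- `unitPow k` is the stage of `sset^{∘k} ∘ 𝟏` inside `SSet^{⋉k} ⋉ 𝟏`. -/
def unitPow : ℕ → Stage.{u}
  | 0 => ⟨one, Set.univ, Subcat.all _⟩
  | k + 1 => (unitPow k).next

/-- Multiplication of the factors number `i` and `i + 1` (counted from `0`),
`SSet^{⋉(k+2)} ⟶ SSet^{⋉(k+1)}`. -/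
def mulAt : (k : ℕ) → Fin (k + 1) → ((ssetPow.{u} (k + 1)).amb ⟶ (ssetPow.{u} k).amb)
  | 0, _ => sSetMul
  | k + 1, ⟨0, _⟩ => assoc sSetDiagram sSetDiagram (ssetPow k).amb ≫ semiMap sSetMul (𝟙 _)
  | k + 1, ⟨i + 1, h⟩ => semiMap (𝟙 _) (mulAt k ⟨i, Nat.lt_of_succ_lt_succ h⟩)

/-- Insertion of the unit in front of the factor number `i` (counted from `0`),
`SSet^{⋉(k+1)} ⟶ SSet^{⋉(k+2)}`. -/
def unitAt : (k : ℕ) → Fin (k + 1) → ((ssetPow.{u} k).amb ⟶ (ssetPow.{u} (k + 1)).amb)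
  | k, ⟨0, _⟩ => leftUnitorInv (ssetPow k).amb ≫ semiMap sSetUnit (𝟙 _)
  | k + 1, ⟨i + 1, h⟩ => semiMap (𝟙 _) (unitAt k ⟨i, Nat.lt_of_succ_lt_succ h⟩)

/-- The unit `𝟏 ⟶ SSet` in the last factor, `SSet^{⋉k} ⋉ 𝟏 ⟶ SSet^{⋉(k+1)}`. -/
def lastUnit : (k : ℕ) → ((unitPow.{u} k).amb ⟶ (ssetPow.{u} k).amb)
  | 0 => sSetUnit
  | k + 1 => semiMap (𝟙 _) (lastUnit k)

/-- Two morphisms of diagrams agree up to a canonical isomorphism: there is exactly one natural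
isomorphism of their functors that is compatible with their natural transformations. -/
def CanonicallyIso {D E : CatDiagram.{u}} (m n : D ⟶ E) : Prop :=
  ∃! θ : m.functor ≅ n.functor, ∀ d, E.fib.map (θ.hom.app d) ≫ n.trans.app d = m.trans.app d

/-!
The morphisms of all the subcategories `sset^{∘k}` and `sset^{∘k} ∘ 𝟏` are monomorphisms
(`Stage.AllMono`), and this makes fibrations elementary. An injective map of simplicial sets is a Kan
fibration exactly if its image is a union of connected components, that is, if a simplex lies in the
image as soon as one of its restrictions does (`SSet.rlp_J_iff_of_mono`). By the Yoneda lemma the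
`I`-points of `{S, ψ}` are the pairs of a simplex `s` of `S` and a morphism `I ⟶ ψ s` (`Points`), so a
monomorphism of diagrams is a fibration exactly if it is injective on simplices and detects points in
this sense (`DetectsPoints`, `isDiagramFibration_iff`).

A morphism `m` of ambient diagrams with underlying functor `F` is shown to preserve the subcategories
(`Stage.Restricts`) together with the property that, for every generator `I` of the target, the functor
`Hom(I, F -)` is corepresented by a generator of the source (`Stage.CorepGenerators`). The
corepresenting generators turn points of `{S, ψ ⋙ F}` into points of `{S, ψ}`, so both properties pass
from `m` to `SSet ⋉ m`. This reduces everything to the operations on the first factors. The unit in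
front gives rise to constant simplicial sets of points, between which points are always detected. For the
multiplication of the first two factors, the `I`-points of the diagonal are the diagonal of the
bisimplicial set `(n, k) ↦ Hom(I[k][n], -)`: a fibration in `sset ∘ (sset ∘ -)` detects points in each
of the two directions, hence along the diagonal (`DetectsPoints.mulFirst`).

The monoid laws are the evident bijections `((s, t), w) ↦ (s, (t, w))`, `(pt, s) ↦ s` and
`(s, pt) ↦ s`. They are the only compatible isomorphisms, because a simplex of each of the targets is
determined by its image in the diagram of categories (`canonicallyIso_restrict`).
-/

/-! ### Injective Kan fibrations -/

theorem SSet.exists_lift_of_mono {X Y Z : SSet.{u}} (g : X ⟶ Y) [Mono g] (h : Z ⟶ Y)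
    (w : ∀ n (z : Z.obj n), h.app n z ∈ Set.range (g.app n)) : ∃ k : Z ⟶ X, k ≫ g = h := by
  have inj : ∀ n, Function.Injective (g.app n) := fun n =>
    (mono_iff_injective _).1 inferInstance
  choose k hk using w
  refine ⟨{ app n := TypeCat.ofHom (k n), naturality := fun n m θ => ?_ }, ?_⟩
  · refine ConcreteCategory.hom_ext _ _ fun z => inj m ?_
    have h₁ := ConcreteCategory.congr_hom (g.naturality θ) (k n z)
    have h₂ := ConcreteCategory.congr_hom (h.naturality θ) z
    refine (hk m _).trans (h₂.trans ?_)
    refine Eq.trans ?_ h₁.symm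
    exact congrArg (Y.map θ) (hk n z).symm
  · refine NatTrans.ext (funext fun n => ConcreteCategory.hom_ext _ _ fun z => hk n z)

open Simplicial in
/-- The image of an injective Kan fibration contains every simplex of which it contains a vertex:
the image is a union of connected components. -/
theorem SSet.mem_range_of_vertex {X Y : SSet.{u}} (g : X ⟶ Y) [Mono g]
    (hg : SSet.modelCategoryQuillen.J.rlp g) (n : ℕ) (y : Y.obj (op ⦋n⦌)) (i : Fin (n + 1))
    (hy : Y.map (SimplexCategory.const ⦋0⦌ ⦋n⦌ i).op y ∈ Set.range (g.app (op ⦋0⦌))) :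
    y ∈ Set.range (g.app (op ⦋n⦌)) := by
  induction n with
  | zero =>
    have e : SimplexCategory.const ⦋0⦌ ⦋0⦌ i = 𝟙 _ := Subsingleton.elim _ _
    rw [e] at hy
    simpa using hy
  | succ n ih =>
    -- every face through the vertex `i` lies in `X`, hence so does the horn `Λ[n + 1, i]`
    have face : ∀ j, j ≠ i → Y.map (SimplexCategory.δ j).op y ∈ Set.range (g.app (op ⦋n⦌)) := by
      intro j hj
      obtain ⟨i', rfl⟩ := Fin.exists_succAbove_eq hj.symm
      refine ih _ i' ?_
      have e : SimplexCategory.const ⦋0⦌ ⦋n + 1⦌ (j.succAbove i') =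
          SimplexCategory.const ⦋0⦌ ⦋n⦌ i' ≫ SimplexCategory.δ j := by
        ext; rfl
      rw [e, op_comp, Y.map_comp] at hy
      exact hy
    obtain ⟨k, hk⟩ := SSet.exists_lift_of_mono g (Λ[n + 1, i].ι ≫ SSet.yonedaEquiv.symm y) (by
      rintro ⟨⟨m⟩⟩ ⟨z, hz⟩
      obtain ⟨j, hj, hjz⟩ := (SSet.mem_horn_iff_notMem_range z i).1 hz
      obtain ⟨x, hx⟩ := face j hj
      obtain ⟨θ, rfl⟩ := SSet.stdSimplex.objEquiv.symm.surjective z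
      have e := SimplexCategory.factor_δ_spec θ j (fun a ha => hjz ⟨a, ha⟩)
      refine ⟨X.map (SimplexCategory.factor_δ θ j).op x, ?_⟩
      refine (ConcreteCategory.congr_hom (g.naturality (SimplexCategory.factor_δ θ j).op) x).trans ?_
      refine (congrArg (Y.map (SimplexCategory.factor_δ θ j).op) hx).trans ?_
      change _ = Y.map θ.op y
      nth_rw 2 [← e]
      simp)
    have := hg _ (SSet.modelCategoryQuillen.horn_ι_mem_J (n + 1) i)
    have sq : CommSq k Λ[n + 1, i].ι g (SSet.yonedaEquiv.symm y) := ⟨hk⟩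
    refine ⟨SSet.yonedaEquiv sq.lift, ?_⟩
    rw [← SSet.yonedaEquiv_comp, sq.fac_right, Equiv.apply_symm_apply]

open Simplicial in
/-- An injective map is a Kan fibration if and only if its image contains every simplex of which it
contains some restriction. -/
theorem SSet.rlp_J_iff_of_mono {X Y : SSet.{u}} (g : X ⟶ Y) [Mono g] :
    SSet.modelCategoryQuillen.J.rlp g ↔ ∀ ⦃n m : SimplexCategoryᵒᵖ⦄ (θ : n ⟶ m) (y : Y.obj n),
      Y.map θ y ∈ Set.range (g.app m) → y ∈ Set.range (g.app n) := by
  constructor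
  · rintro hg ⟨⟨n⟩⟩ ⟨⟨m⟩⟩ θ y ⟨x, hx⟩
    refine SSet.mem_range_of_vertex g hg n y (θ.unop 0)
      ⟨X.map (SimplexCategory.const ⦋0⦌ ⦋m⦌ 0).op x, ?_⟩
    refine (ConcreteCategory.congr_hom (g.naturality (SimplexCategory.const ⦋0⦌ ⦋m⦌ 0).op) x).trans ?_
    refine (congrArg (Y.map (SimplexCategory.const ⦋0⦌ ⦋m⦌ 0).op) hx).trans ?_
    have e : SimplexCategory.const ⦋0⦌ ⦋n⦌ (θ.unop 0) =
      SimplexCategory.const ⦋0⦌ ⦋m⦌ 0 ≫ θ.unop := by ext; rfl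
    have h := ConcreteCategory.congr_hom (Y.map_comp θ (SimplexCategory.const ⦋0⦌ ⦋m⦌ 0).op) y
    refine h.symm.trans ?_
    congr 3
  · intro hg A B j hj
    simp only [SSet.modelCategoryQuillen.J, MorphismProperty.iSup_iff] at hj
    obtain ⟨n, ⟨i⟩⟩ := hj
    refine ⟨fun {t b} sq => ?_⟩
    obtain ⟨y, rfl⟩ := SSet.yonedaEquiv.symm.surjective b
    -- a single simplex of the horn suffices to see that the whole simplex lies in `X`
    have hv : SSet.stdSimplex.objEquiv.symm (SimplexCategory.const ⦋0⦌ ⦋n + 1⦌ i) ∈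
        Λ[n + 1, i].obj (op ⦋0⦌) := by
      rw [SSet.mem_horn_iff_notMem_range]
      obtain ⟨j, hj⟩ := exists_ne i
      exact ⟨j, hj, fun ⟨a, ha⟩ => hj ha.symm⟩
    obtain ⟨x, hx⟩ := hg (SimplexCategory.const ⦋0⦌ ⦋n + 1⦌ i).op y
      ⟨t.app _ ⟨_, hv⟩, by
        refine (ConcreteCategory.congr_hom (congrArg (fun f => NatTrans.app f _) sq.w) _).trans ?_
        rfl⟩
    have hb : SSet.yonedaEquiv.symm x ≫ g = SSet.yonedaEquiv.symm y := by
      rw [SSet.yonedaEquiv_symm_comp, hx]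
    refine ⟨⟨⟨SSet.yonedaEquiv.symm x, ?_, hb⟩⟩⟩
    rw [← cancel_mono g, Category.assoc, hb, sq.w]

/-! ### Points of diagrams and fibrations -/

section Points

variable {M : Type (u + 1)} [Category.{u} M]

/-- The `n`-simplices of the simplicial set of `I`-points of a diagram `{S, ψ}`, in the form that the
Yoneda lemma gives them: pairs of an `n`-simplex `s` of `S` and a morphism `I ⟶ ψ s`. -/
abbrev Points (I : M) (X : SemiObj sSetDiagram.{u} M) (n : SimplexCategoryᵒᵖ) : Type u :=
  Σ s : X.idx.obj n, I ⟶ X.diag.obj ⟨n, s⟩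

namespace Points

variable {I : M} {X Y Z : SemiObj sSetDiagram.{u} M} {n m : SimplexCategoryᵒᵖ}

/-- The action of morphisms of diagrams on points. -/
abbrev map (g : X ⟶ Y) (p : Points I X n) : Points I Y n :=
  ⟨(SemiObj.Hom.idx g).app n p.1, p.2 ≫ (SemiObj.Hom.trans g).app ⟨n, p.1⟩⟩

/-- The action of simplicial operators on points. -/
abbrev restrict (θ : n ⟶ m) (p : Points I X n) : Points I X m :=
  ⟨X.idx.map θ p.1,
    p.2 ≫ X.diag.map (CategoryOfElements.homMk (F := X.idx) ⟨n, p.1⟩ ⟨m, X.idx.map θ p.1⟩ θ rfl)⟩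

/-- Precomposition of a point with a morphism of generators. -/
abbrev precomp {J : M} (j : J ⟶ I) (p : Points I X n) : Points J X n := ⟨p.1, j ≫ p.2⟩

/-- Points obtained by transport along two morphisms over the same simplicial operator agree, although
the ends of the morphisms are only propositionally equal. -/
theorem mk_congr {s : X.idx.obj n} (a : I ⟶ X.diag.obj ⟨n, s⟩) {t t' : X.idx.obj m}
    (f : @Quiver.Hom X.idx.Elements _ ⟨n, s⟩ ⟨m, t⟩)
    (f' : @Quiver.Hom X.idx.Elements _ ⟨n, s⟩ ⟨m, t'⟩) (h : f.1 = f'.1) :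
    (⟨t, a ≫ X.diag.map f⟩ : Points I X m) = ⟨t', a ≫ X.diag.map f'⟩ := by
  obtain rfl : t = t' :=
    f.2.symm.trans ((congrArg (fun θ => X.idx.map θ s) h).trans f'.2)
  obtain rfl : f = f' := CategoryOfElements.ext _ _ _ h
  rfl

theorem mk_eq {s t : X.idx.obj n} (a : I ⟶ X.diag.obj ⟨n, s⟩)
    (f : @Quiver.Hom X.idx.Elements _ ⟨n, s⟩ ⟨n, t⟩) (h : f.1 = 𝟙 n) :
    (⟨t, a ≫ X.diag.map f⟩ : Points I X n) = ⟨s, a⟩ := by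
  refine (mk_congr a f (CategoryStruct.id (obj := X.idx.Elements) ⟨n, s⟩) h).trans ?_
  refine Sigma.ext rfl (heq_of_eq ?_)
  exact (congrArg (a ≫ ·) (X.diag.map_id _)).trans (Category.comp_id a)

theorem comp_trans_app (g : X ⟶ Y) (h : Y ⟶ Z) (a : X.idx.Elements) :
    (SemiObj.Hom.trans (g ≫ h)).app a = (SemiObj.Hom.trans g).app a ≫
      (SemiObj.Hom.trans h).app ((sSetDiagram.fib.map (SemiObj.Hom.idx g)).toFunctor.obj a) := by
  exact (SemiObj.comp_trans_app g h a).trans (congrArg _ (Category.comp_id _))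

/-- The point classified by a morphism out of `I[n]`. -/
def ofHom {n : SimplexCategory} (h : (pointDiagram I).obj n ⟶ X) : Points I X (op n) :=
  ⟨(SemiObj.Hom.idx h).app (op n) (SSet.stdSimplex.objEquiv.symm (𝟙 n)),
    (SemiObj.Hom.trans h).app ⟨op n, SSet.stdSimplex.objEquiv.symm (𝟙 n)⟩⟩

theorem ofHom_comp {n : SimplexCategory} (h : (pointDiagram I).obj n ⟶ X) (g : X ⟶ Y) :
    ofHom (h ≫ g) = map g (ofHom h) :=
  Sigma.ext rfl (heq_of_eq (comp_trans_app h g _))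

/-- The object `(n, 𝟙)` of the category of elements of `Δ[n]` maps to every object. -/
abbrev fromId {n : SimplexCategory} (e : (SSet.stdSimplex.{u}.obj n).Elements) :
    @Quiver.Hom (SSet.stdSimplex.{u}.obj n).Elements _
      ⟨op n, SSet.stdSimplex.objEquiv.symm (𝟙 n)⟩ e :=
  ⟨(SSet.stdSimplex.objEquiv e.2).op,
    SSet.stdSimplex.objEquiv.injective (Category.comp_id (SSet.stdSimplex.objEquiv e.2))⟩

/-- A morphism out of `I[n]` is determined by the point that it classifies. -/
theorem trans_app_eq {n : SimplexCategory} (h : (pointDiagram I).obj n ⟶ X)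
    (e : (SSet.stdSimplex.{u}.obj n).Elements) :
    (SemiObj.Hom.trans h).app e = (ofHom h).2 ≫
      X.diag.map ((sSetDiagram.fib.map (SemiObj.Hom.idx h)).toFunctor.map (fromId e)) :=
  (Category.id_comp _).symm.trans ((SemiObj.Hom.trans h).naturality (fromId e))

theorem ofHom_precomp {n m : SimplexCategory} (θ : m ⟶ n) (h : (pointDiagram I).obj n ⟶ X) :
    ofHom ((pointDiagram I).map θ ≫ h) = restrict θ.op (ofHom h) := by
  refine Eq.trans (b := ⟨_, (ofHom h).2 ≫ X.diag.map ((sSetDiagram.fib.map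
    (SemiObj.Hom.idx h)).toFunctor.map (fromId ⟨op m, SSet.stdSimplex.objEquiv.symm θ⟩))⟩)
    (Sigma.ext ?_ ?_) ?_
  · exact congrArg ((SemiObj.Hom.idx h).app (op m) <| SSet.stdSimplex.objEquiv.symm ·)
      (Category.id_comp θ)
  · have e : (SSet.stdSimplex.map θ).app (op m) (SSet.stdSimplex.objEquiv.symm (𝟙 m)) =
        SSet.stdSimplex.objEquiv.symm θ :=
      congrArg SSet.stdSimplex.objEquiv.symm (Category.id_comp θ)
    refine (heq_of_eq ((comp_trans_app _ h _).trans (Category.id_comp _))).trans ?_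
    refine HEq.trans ?_ (heq_of_eq (trans_app_eq h ⟨op m, SSet.stdSimplex.objEquiv.symm θ⟩))
    exact congr_arg_heq (fun x => (SemiObj.Hom.trans h).app ⟨op m, x⟩) e
  · exact mk_congr _ _ _ rfl

theorem ofHom_injective {n : SimplexCategory} :
    Function.Injective (ofHom : ((pointDiagram I).obj n ⟶ X) → Points I X (op n)) := by
  intro h h' e
  have e₁ : SemiObj.Hom.idx h = SemiObj.Hom.idx h' :=
    SSet.yonedaEquiv.injective (congrArg Sigma.fst e)
  refine SemiObj.Hom.ext' e₁ ?_
  obtain ⟨i, t⟩ := h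
  obtain ⟨i', t'⟩ := h'
  obtain rfl : i = i' := e₁
  ext a
  refine (trans_app_eq ⟨i, t'⟩ a).trans ?_
  refine Eq.trans ?_ (congrArg (· ≫ _) (trans_app_eq ⟨i, t⟩ a).symm)
  have : (ofHom (I := I) (X := X) ⟨i, t⟩).2 = (ofHom (I := I) (X := X) ⟨i, t'⟩).2 :=
    eq_of_heq (Sigma.ext_iff.1 e).2
  rw [this]
  exact (Category.comp_id _).symm

/-- The morphism out of `I[n]` that classifies a point. -/
def toHom {n : SimplexCategory} (p : Points I X (op n)) : (pointDiagram I).obj n ⟶ X :=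
  ⟨SSet.yonedaEquiv.symm p.1,
    { app e := p.2 ≫ X.diag.map (CategoryOfElements.homMk (F := X.idx) ⟨op n, p.1⟩
        ⟨e.1, X.idx.map (SSet.stdSimplex.objEquiv e.2).op p.1⟩ (SSet.stdSimplex.objEquiv e.2).op rfl)
      naturality e e' f := by
        refine (Category.id_comp _).trans ?_
        refine Eq.trans ?_ (Category.assoc _ _ _).symm
        refine congrArg (p.2 ≫ ·) ?_
        refine Eq.trans ?_ (X.diag.map_comp _ _)
        refine congrArg X.diag.map (CategoryOfElements.ext _ _ _ ?_)
        exact congrArg (fun x => (SSet.stdSimplex.objEquiv x).op) f.2.symm }⟩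

/-- The Yoneda lemma for points: morphisms out of `I[n]` are the `n`-simplices of the `I`-points. -/
noncomputable def homEquiv (I : M) (X : SemiObj sSetDiagram.{u} M) (n : SimplexCategory) :
    ((pointDiagram I).obj n ⟶ X) ≃ Points I X (op n) :=
  Equiv.ofBijective ofHom ⟨ofHom_injective, fun p => ⟨toHom p, mk_eq _ _ rfl⟩⟩

end Points

/-- A morphism of diagrams detects `I`-points: a point of the target lies in the image as soon as
one of its restrictions does. -/
def DetectsPoints (I : M) {X Y : SemiObj sSetDiagram.{u} M} (g : X ⟶ Y) : Prop :=
  ∀ ⦃n m : SimplexCategoryᵒᵖ⦄ (θ : n ⟶ m) (p : Points I Y n),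
    p.restrict θ ∈ Set.range (Points.map (I := I) g) → p ∈ Set.range (Points.map (I := I) g)

/-- For monomorphisms the lifting property in the definition of fibrations becomes a statement about
images of points. -/
theorem isDiagramFibration_iff (𝓘 : Set M) {X Y : SemiObj sSetDiagram.{u} M} (g : X ⟶ Y) [Mono g] :
    IsDiagramFibration 𝓘 g ↔ Mono (C := SSet.{u}) (SemiObj.Hom.idx g) ∧
      ∀ I ∈ 𝓘, DetectsPoints I g := by
  refine and_congr_right fun _ => forall₂_congr fun I _ => ?_
  have : Mono ((iPoints I).map g) := by
    refine @NatTrans.mono_of_mono_app _ _ _ _ _ _ _ fun n => ?_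
    rw [mono_iff_injective]
    intro h h' e
    exact (cancel_mono g).1 e
  rw [SSet.rlp_J_iff_of_mono]
  have key : ∀ (n : SimplexCategoryᵒᵖ) (h : (pointDiagram I).obj n.unop ⟶ Y),
      h ∈ Set.range (((iPoints I).map g).app n) ↔
        Points.homEquiv I Y n.unop h ∈ Set.range (Points.map (I := I) g) := by
    intro n h
    constructor
    · rintro ⟨k, rfl⟩
      exact ⟨Points.homEquiv I X n.unop k, (Points.ofHom_comp k g).symm⟩
    · rintro ⟨p, hp⟩
      obtain ⟨k, rfl⟩ := (Points.homEquiv I X n.unop).surjective p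
      refine ⟨k, (Points.homEquiv I Y n.unop).injective (Eq.trans ?_ hp)⟩
      exact Points.ofHom_comp k g
  refine forall₂_congr fun n m => forall_congr' fun θ => ?_
  refine (Equiv.forall_congr (Points.homEquiv I Y n.unop) fun {h} => ?_)
  refine imp_congr ((key m _).trans ?_) (key n h)
  have : Points.homEquiv I Y m.unop (((iPoints I).obj Y).map θ h) =
      Points.restrict θ (Points.homEquiv I Y n.unop h) := Points.ofHom_precomp θ.unop h
  exact iff_of_eq (congrArg (· ∈ _) this)

end Points

theorem SemiObj.mono_of_mono {D : CatDiagram.{u}} {M : Type (u + 1)} [Category.{u} M]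
    {X Y : SemiObj D M} (g : X ⟶ Y) [Mono (SemiObj.Hom.idx g)]
    [∀ a, Mono ((SemiObj.Hom.trans g).app a)] : Mono g where
  right_cancellation {Z} h h' e := by
    have e₁ : SemiObj.Hom.idx h = SemiObj.Hom.idx h' :=
      (cancel_mono (SemiObj.Hom.idx g)).1 (congrArg SemiObj.Hom.idx e)
    refine SemiObj.hom_ext e₁ fun a => ?_
    have := SemiObj.trans_app_congr e a
    rw [SemiObj.comp_trans_app, SemiObj.comp_trans_app] at this
    obtain ⟨i, t⟩ := h
    obtain ⟨i', t'⟩ := h'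
    obtain rfl : i = i' := e₁
    simp only [Category.assoc, eqToHom_trans] at this
    simp only [← Category.assoc] at this
    rw [cancel_mono, cancel_mono] at this
    simpa using this.symm

/-! ### Morphisms that preserve the subcategories -/

namespace Stage

theorem mem_next_obj_iff {S : Stage.{u}} (x : SemiObj sSetDiagram.{u} S.amb.base) :
    S.next.sub.obj x ↔ (∀ a, S.sub.obj (x.diag.obj a)) ∧
      ∀ ⦃a b⦄ (α : a ⟶ b), S.sub.hom (x.diag.map α) :=
  ⟨fun h => h.2, fun h => ⟨trivial, h⟩⟩

/-- All morphisms of the subcategory of a stage are monomorphisms. -/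
def AllMono (S : Stage.{u}) : Prop := ∀ ⦃x y⦄ (g : x ⟶ y), S.sub.hom g → Mono g

theorem AllMono.next {S : Stage.{u}} (hS : S.AllMono) : S.next.AllMono := fun _ _ g hg =>
  have : Mono (C := SSet.{u}) (SemiObj.Hom.idx (D := sSetDiagram) g) := hg.1.1
  have : ∀ a, Mono ((SemiObj.Hom.trans (D := sSetDiagram) g).app a) := fun a => hS _ (hg.1.2 a)
  SemiObj.mono_of_mono (D := sSetDiagram) g

/-- The morphisms of `sset ∘ S`, with fibrations expressed by points. -/
theorem mem_next_hom_iff {S : Stage.{u}} (hS : S.AllMono)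
    {x y : SemiObj sSetDiagram.{u} S.amb.base} (g : x ⟶ y) :
    S.next.sub.hom g ↔ Mono (C := SSet.{u}) (SemiObj.Hom.idx g) ∧
      (∀ a, S.sub.hom ((SemiObj.Hom.trans g).app a)) ∧ ∀ I ∈ S.gen, DetectsPoints I g := by
  constructor
  · intro h
    have : Mono g := hS.next g h
    exact ⟨h.1.1, h.1.2, ((isDiagramFibration_iff S.gen g).1 h.2).2⟩
  · rintro ⟨h₁, h₂, h₃⟩
    have : Mono (C := SSet.{u}) (SemiObj.Hom.idx (D := sSetDiagram) g) := h₁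
    have : ∀ a, Mono ((SemiObj.Hom.trans (D := sSetDiagram) g).app a) := fun a => hS _ (h₂ a)
    have : Mono g := SemiObj.mono_of_mono (D := sSetDiagram) g
    exact ⟨⟨h₁, h₂⟩, (isDiagramFibration_iff S.gen g).2 ⟨h₁, h₃⟩⟩

/-- A morphism of the ambient diagrams restricts to the subcategories of two stages. -/
structure Restricts {S T : Stage.{u}} (m : S.amb ⟶ T.amb) : Prop where
  obj : ∀ x, S.sub.obj x → T.sub.obj (m.functor.obj x)
  hom : ∀ ⦃x y⦄ (g : x ⟶ y), S.sub.obj x → S.sub.obj y → S.sub.hom g →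
    T.sub.hom (m.functor.map g)

/-- The functor underlying a morphism of ambient diagrams takes points with respect to generators to
points with respect to generators: for every generator `I` of the target the functor `Hom(I, F -)` is
corepresented by a generator of the source. -/
def CorepGenerators {S T : Stage.{u}} (m : S.amb ⟶ T.amb) : Prop :=
  ∀ I ∈ T.gen, ∃ J ∈ S.gen, Nonempty ((m.functor ⋙ coyoneda.obj (op I)).CorepresentableBy J)

end Stage

section SemiMapId

variable {A B : CatDiagram.{u}} (m : A ⟶ B)

/-- The functor `{S, ψ} ↦ {S, ψ ⋙ F}` underlying `SSet ⋉ {F, ρ}`. -/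
abbrev semiMapId : SemiObj sSetDiagram.{u} A.base ⥤ SemiObj sSetDiagram.{u} B.base :=
  (semiMap (𝟙 sSetDiagram) m).functor

theorem semiMapId_trans_app {X Y : SemiObj sSetDiagram.{u} A.base} (g : X ⟶ Y)
    (a : X.idx.Elements) : (SemiObj.Hom.trans ((semiMapId m).map g)).app a =
      m.functor.map ((SemiObj.Hom.trans g).app a) :=
  (congrArg (m.functor.map ((SemiObj.Hom.trans g).app a) ≫ ·) (eqToHom_app _ a)).trans
    (Category.comp_id _)

variable {m} {I : B.base} {J : A.base}
  (e : (m.functor ⋙ coyoneda.obj (op I)).CorepresentableBy J)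

theorem corep_comp {x y : A.base} (f : J ⟶ x) (g : x ⟶ y) :
    (show I ⟶ m.functor.obj y from e.homEquiv (f ≫ g)) =
      (show I ⟶ m.functor.obj x from e.homEquiv f) ≫ m.functor.map g :=
  e.homEquiv_comp g f

/-- The points of `{S, ψ ⋙ F}` as points of `{S, ψ}`. -/
def pointsCorep (X : SemiObj sSetDiagram.{u} A.base) (n : SimplexCategoryᵒᵖ) :
    Points J X n ≃ Points I ((semiMapId m).obj X) n :=
  Equiv.sigmaCongrRight fun s => e.homEquiv (Y := X.diag.obj ⟨n, s⟩)

theorem pointsCorep_map {X Y : SemiObj sSetDiagram.{u} A.base} (g : X ⟶ Y)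
    {n : SimplexCategoryᵒᵖ} (p : Points J X n) :
    pointsCorep e Y n (p.map g) = (pointsCorep e X n p).map ((semiMapId m).map g) :=
  Sigma.ext rfl (heq_of_eq ((corep_comp e _ _).trans
    (congrArg (_ ≫ ·) (semiMapId_trans_app m g _).symm)))

theorem pointsCorep_restrict {X : SemiObj sSetDiagram.{u} A.base}
    {n k : SimplexCategoryᵒᵖ} (θ : n ⟶ k) (p : Points J X n) :
    pointsCorep e X k (p.restrict θ) = (pointsCorep e X n p).restrict θ :=
  Sigma.ext rfl (heq_of_eq (corep_comp e _ _))

theorem DetectsPoints.semiMapId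
    (e : (m.functor ⋙ coyoneda.obj (op I)).CorepresentableBy J) {X Y : SemiObj sSetDiagram.{u} A.base} {g : X ⟶ Y}
    (hg : DetectsPoints J g) : DetectsPoints I ((semiMapId m).map g) := by
  intro n k θ p
  obtain ⟨p, rfl⟩ := (pointsCorep e Y n).surjective p
  rintro ⟨q, hq⟩
  obtain ⟨q, rfl⟩ := (pointsCorep e X k).surjective q
  rw [← pointsCorep_restrict, ← pointsCorep_map] at hq
  obtain ⟨r, rfl⟩ := hg θ p ⟨q, (pointsCorep e Y k).injective hq⟩
  exact ⟨_, (pointsCorep_map e g r).symm⟩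

/-- The object `J[n]` corepresents the `I[n]`-points of `{S, ψ ⋙ F}` if `J` corepresents
`Hom(I, F -)`. -/
noncomputable def semiMapIdCorep (n : SimplexCategory) :
    (semiMapId m ⋙ coyoneda.obj (op ((pointDiagram I).obj n))).CorepresentableBy
      ((pointDiagram J).obj n) where
  homEquiv {X} := (Points.homEquiv J X n).trans
    ((pointsCorep e X (op n)).trans (Points.homEquiv I ((semiMapId m).obj X) n).symm)
  homEquiv_comp {X Y} g f := by
    refine (Points.homEquiv I ((semiMapId m).obj Y) n).injective ?_
    refine (Equiv.apply_symm_apply _ _).trans ?_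
    refine Eq.trans ?_ (Points.ofHom_comp _ ((semiMapId m).map g)).symm
    refine Eq.trans ?_ (congrArg _ (Equiv.apply_symm_apply (Points.homEquiv I _ n) _).symm)
    exact (congrArg _ (Points.ofHom_comp f g)).trans (pointsCorep_map e g _)

end SemiMapId

namespace Stage

/-- If `F` restricts to the subcategories and takes points to points, then composition with `F` also
preserves fibrations of diagrams. -/
theorem Restricts.semiMap {S T : Stage.{u}} (hS : S.AllMono) (hT : T.AllMono)
    {m : S.amb ⟶ T.amb} (h : Restricts m) (c : CorepGenerators m) :
    Restricts (S := S.next) (T := T.next) (semiMap (𝟙 sSetDiagram) m) where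
  obj x hx := (mem_next_obj_iff (S := T) ((semiMapId m).obj x)).2
    ⟨fun a => h.obj _ (hx.2.1 a), fun a b α => h.hom _ (hx.2.1 a) (hx.2.1 b) (hx.2.2 α)⟩
  hom x y g hx hy hg := by
    obtain ⟨h₁, h₂, h₃⟩ := (mem_next_hom_iff hS g).1 hg
    refine (mem_next_hom_iff hT ((semiMapId m).map g)).2 ⟨h₁, fun a => ?_, fun I hI => ?_⟩
    · exact (congrArg (T.sub.hom ·) (semiMapId_trans_app m g a)).mpr
        (h.hom _ (hx.2.1 _) (hy.2.1 _) (h₂ a))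
    · obtain ⟨J, hJ, ⟨e⟩⟩ := c I hI
      exact DetectsPoints.semiMapId e (h₃ J hJ)

theorem CorepGenerators.semiMap {S T : Stage.{u}} {m : S.amb ⟶ T.amb} (c : CorepGenerators m) :
    CorepGenerators (S := S.next) (T := T.next) (semiMap (𝟙 sSetDiagram) m) := by
  rintro _ ⟨I, hI, n, rfl⟩
  obtain ⟨J, hJ, ⟨e⟩⟩ := c I hI
  exact ⟨_, ⟨J, hJ, n, rfl⟩, ⟨semiMapIdCorep e (SimplexCategory.mk n)⟩⟩

end Stage

/-! ### Multiplication of the first two of several factors -/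

section MulFirst

variable {A : CatDiagram.{u}}

/-- The multiplication of the first two factors of `SSet ⋉ (SSet ⋉ A)`. -/
abbrev mulFirst (A : CatDiagram.{u}) :
    semi sSetDiagram (semi sSetDiagram A) ⟶ semi sSetDiagram A :=
  assoc sSetDiagram sSetDiagram A ≫ semiMap sSetMul (𝟙 A)

theorem mulFirst_trans_app {X Y : SemiObj sSetDiagram.{u} (SemiObj sSetDiagram.{u} A.base)}
    (g : X ⟶ Y) {n : SimplexCategoryᵒᵖ} (s : X.idx.obj n) (t : (X.diag.obj ⟨n, s⟩).idx.obj n) :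
    (SemiObj.Hom.trans ((mulFirst A).functor.map g)).app ⟨n, ⟨s, t⟩⟩ =
      (SemiObj.Hom.trans ((SemiObj.Hom.trans g).app ⟨n, s⟩)).app ⟨n, t⟩ :=
  (congrArg (_ ≫ ·) (eqToHom_app _ _)).trans (Category.comp_id _)

/-- The `n`-simplices of the `I`-points of the diagonal are the `n`-simplices of the
`I[n]`-points. -/
noncomputable def pointsMulFirst (I : A.base)
    (X : SemiObj sSetDiagram.{u} (SemiObj sSetDiagram.{u} A.base)) (n : SimplexCategory) :
    Points ((pointDiagram I).obj n) X (op n) ≃ Points I ((mulFirst A).functor.obj X) (op n) :=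
  (Equiv.sigmaCongrRight fun s => Points.homEquiv I (X.diag.obj ⟨op n, s⟩) n).trans
    (Equiv.sigmaAssoc fun (s : X.idx.obj (op n)) t =>
      I ⟶ (X.diag.obj ⟨op n, s⟩).diag.obj ⟨op n, t⟩).symm

variable {I : A.base}

theorem pointsMulFirst_map {X Y : SemiObj sSetDiagram.{u} (SemiObj sSetDiagram.{u} A.base)}
    (g : X ⟶ Y) {n : SimplexCategory} (p : Points ((pointDiagram I).obj n) X (op n)) :
    pointsMulFirst I Y n (p.map g) = (pointsMulFirst I X n p).map ((mulFirst A).functor.map g) := by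
  obtain ⟨s, h⟩ := p
  refine Sigma.ext rfl (heq_of_eq ?_)
  refine (Points.comp_trans_app h ((SemiObj.Hom.trans g).app ⟨op n, s⟩) _).trans ?_
  exact congrArg (_ ≫ ·) (mulFirst_trans_app g s (Points.ofHom h).1).symm

/-- Restricting a point of the diagonal along `θ` is restricting the corresponding `I[n]`-point along
`θ` in both directions. -/
theorem pointsMulFirst_restrict {X : SemiObj sSetDiagram.{u} (SemiObj sSetDiagram.{u} A.base)}
    {n k : SimplexCategory} (θ : op n ⟶ op k) (p : Points ((pointDiagram I).obj n) X (op n)) :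
    pointsMulFirst I X k ((p.restrict θ).precomp ((pointDiagram I).map θ.unop)) =
      (pointsMulFirst I X n p).restrict θ := by
  obtain ⟨s, h⟩ := p
  let α : @Quiver.Hom X.idx.Elements _ ⟨op n, s⟩ ⟨op k, X.idx.map θ s⟩ := ⟨θ, rfl⟩
  have e : Points.ofHom ((pointDiagram I).map θ.unop ≫ h ≫ X.diag.map α) =
      ((Points.ofHom h).map (X.diag.map α)).restrict θ :=
    (Points.ofHom_precomp θ.unop _).trans (congrArg (Points.restrict θ) (Points.ofHom_comp h _))
  -- the inner operator can be applied before or after transport along `α`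
  have e' : ((Points.ofHom h).map (X.diag.map α)).restrict θ =
      ⟨(SemiObj.Hom.idx (X.diag.map α)).app (op k) ((X.diag.obj ⟨op n, s⟩).idx.map θ
        (Points.ofHom h).1), ((Points.ofHom h).2 ≫
          (SemiObj.Hom.trans (X.diag.map α)).app ⟨op n, (Points.ofHom h).1⟩) ≫
            (X.diag.obj ⟨op k, X.idx.map θ s⟩).diag.map ⟨θ,
              (ConcreteCategory.congr_hom ((SemiObj.Hom.idx (X.diag.map α)).naturality θ)
                (Points.ofHom h).1).symm⟩⟩ :=
    Points.mk_congr (X := X.diag.obj ⟨op k, X.idx.map θ s⟩) _ _ _ rfl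
  refine (congrArg (fun q : Points I (X.diag.obj ⟨op k, X.idx.map θ s⟩) (op k) =>
    (⟨⟨X.idx.map θ s, q.1⟩, q.2⟩ : Points I ((mulFirst A).functor.obj X) (op k)))
      (e.trans e')).trans ?_
  exact Sigma.ext rfl (heq_of_eq (Category.assoc _ _ _))

/-- If all components of `g` detect `I`-points, then the operators of the inner direction can be
undone. -/
theorem Points.mem_range_of_precomp {B : Type (u + 1)} [Category.{u} B] {I : B}
    {X Y : SemiObj sSetDiagram.{u} (SemiObj sSetDiagram.{u} B)} {g : X ⟶ Y}
    (hg : ∀ a, DetectsPoints I ((SemiObj.Hom.trans g).app a)) {n k : SimplexCategory} (θ : k ⟶ n)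
    {l : SimplexCategoryᵒᵖ} (p : Points ((pointDiagram I).obj n) Y l)
    (hp : p.precomp ((pointDiagram I).map θ) ∈
      Set.range (Points.map (I := (pointDiagram I).obj k) g)) :
    p ∈ Set.range (Points.map (I := (pointDiagram I).obj n) g) := by
  obtain ⟨s', c⟩ := p
  obtain ⟨⟨s, b⟩, hb⟩ := hp
  obtain ⟨h₁, h₂⟩ := Sigma.mk.inj hb
  subst h₁
  have h := congrArg Points.ofHom (eq_of_heq h₂)
  obtain ⟨q, hq⟩ := hg ⟨l, s⟩ θ.op (Points.ofHom c)
    ⟨Points.ofHom b, (Points.ofHom_comp b _).symm.trans (h.trans (Points.ofHom_precomp θ c))⟩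
  obtain ⟨b', rfl⟩ := (Points.homEquiv I (X.diag.obj ⟨l, s⟩) n).surjective q
  refine ⟨⟨s, b'⟩, Sigma.ext rfl (heq_of_eq ?_)⟩
  exact Points.ofHom_injective ((Points.ofHom_comp b' _).trans hq)

/-- If a morphism of bisimplicial objects detects points in both directions, then its diagonal detects
points: the operator `(θ, θ)` is first undone in the inner and then in the outer direction. -/
theorem DetectsPoints.mulFirst {X Y : SemiObj sSetDiagram.{u} (SemiObj sSetDiagram.{u} A.base)}
    {g : X ⟶ Y} (h₁ : ∀ n : ℕ, DetectsPoints ((pointDiagram I).obj (SimplexCategory.mk n)) g)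
    (h₂ : ∀ a, DetectsPoints I ((SemiObj.Hom.trans g).app a)) :
    DetectsPoints I ((mulFirst A).functor.map g) := by
  rintro ⟨n⟩ ⟨k⟩ θ p
  obtain ⟨p, rfl⟩ := (pointsMulFirst I Y n).surjective p
  rintro ⟨q, hq⟩
  obtain ⟨q, rfl⟩ := (pointsMulFirst I X k).surjective q
  rw [← pointsMulFirst_restrict, ← pointsMulFirst_map] at hq
  obtain ⟨r, rfl⟩ := h₁ n.len θ p (Points.mem_range_of_precomp h₂ θ.unop _
    ⟨q, (pointsMulFirst I Y k).injective hq⟩)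
  exact ⟨_, (pointsMulFirst_map g r).symm⟩

/-- `Hom(I[n], F X) = Hom(I[n][n], X)` for the multiplication `F` of the first two factors. -/
noncomputable def mulFirstCorep (I : A.base) (n : SimplexCategory) :
    ((mulFirst A).functor ⋙ coyoneda.obj (op ((pointDiagram I).obj n))).CorepresentableBy
      ((pointDiagram ((pointDiagram I).obj n)).obj n) where
  homEquiv {X} := (Points.homEquiv ((pointDiagram I).obj n) X n).trans
    ((pointsMulFirst I X n).trans (Points.homEquiv I ((mulFirst A).functor.obj X) n).symm)
  homEquiv_comp {X Y} g f := by
    refine (Points.homEquiv I ((mulFirst A).functor.obj Y) n).injective ?_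
    refine (Equiv.apply_symm_apply _ _).trans ?_
    refine Eq.trans ?_ (Points.ofHom_comp _ ((mulFirst A).functor.map g)).symm
    refine Eq.trans ?_ (congrArg _ (Equiv.apply_symm_apply (Points.homEquiv I _ n) _).symm)
    exact (congrArg _ (Points.ofHom_comp f g)).trans (pointsMulFirst_map g _)

end MulFirst

/-! ### Multiplication of the only two factors -/

theorem mono_diag {X Y : SemiObj sSetDiagram.{u} SSet.{u}} (g : X ⟶ Y)
    (h₁ : Mono (C := SSet.{u}) (SemiObj.Hom.idx g))
    (h₂ : ∀ a, Mono ((SemiObj.Hom.trans g).app a)) : Mono (diagFunctor.map g) := by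
  refine @NatTrans.mono_of_mono_app _ _ _ _ _ _ _ fun n => ?_
  rw [mono_iff_injective]
  rintro ⟨s, t⟩ ⟨s', t'⟩ e
  obtain ⟨e₁, e₂⟩ := Sigma.mk.inj e
  obtain rfl : s = s' := (mono_iff_injective ((SemiObj.Hom.idx g).app n)).1 inferInstance e₁
  have := h₂ ⟨n, s⟩
  obtain rfl : t = t' :=
    (mono_iff_injective (((SemiObj.Hom.trans g).app ⟨n, s⟩).app n)).1 inferInstance (eq_of_heq e₂)
  rfl

/-- `Hom(Δ[n], Δ(S, ψ)) = Hom(Δ[n][n], {S, ψ})`. -/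
noncomputable def sSetMulCorep (n : SimplexCategory) :
    (sSetMul.functor ⋙ coyoneda.obj (op (SSet.stdSimplex.{u}.obj n))).CorepresentableBy
      ((pointDiagram (SSet.stdSimplex.{u}.obj n)).obj n) where
  homEquiv {X} := (Points.homEquiv (SSet.stdSimplex.{u}.obj n) X n).trans
    ((Equiv.sigmaCongrRight fun _ => SSet.yonedaEquiv).trans
      (SSet.yonedaEquiv (X := diagObj X) (n := n)).symm)
  homEquiv_comp {X Y} g f := by
    refine (SSet.yonedaEquiv (X := diagObj Y) (n := n)).injective ?_
    refine (Equiv.apply_symm_apply _ _).trans ?_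
    refine Eq.trans ?_ (SSet.yonedaEquiv_comp _ (diagFunctor.map g)).symm
    refine Eq.trans ?_
      (congrArg _ (Equiv.apply_symm_apply (SSet.yonedaEquiv (X := diagObj X)) _).symm)
    refine (congrArg _ (Points.ofHom_comp f g)).trans ?_
    exact Sigma.ext rfl (heq_of_eq (SSet.yonedaEquiv_comp _ _))

/-! ### Insertion of the unit in front of the first factor -/

section UnitFirst

variable {A : CatDiagram.{u}}

/-- The insertion of the unit in front of the first factor. -/
abbrev unitFirst (A : CatDiagram.{u}) : A ⟶ semi sSetDiagram A :=
  leftUnitorInv A ≫ semiMap sSetUnit (𝟙 A)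

theorem unitFirst_trans_app {x y : A.base} (g : x ⟶ y)
    (a : ((unitFirst A).functor.obj x).idx.Elements) :
    (SemiObj.Hom.trans ((unitFirst A).functor.map g)).app a = g :=
  (congrArg (g ≫ ·) (eqToHom_app _ a)).trans (Category.comp_id _)

/-- The points of a constant diagram on the one-point simplicial set form a constant simplicial
set. -/
theorem Points.unitFirst_restrict {I x : A.base} {n k : SimplexCategoryᵒᵖ} (θ : n ⟶ k)
    (p : Points I ((unitFirst A).functor.obj x) n) :
    p.restrict θ = (⟨⟨⟩, p.2⟩ : Points I ((unitFirst A).functor.obj x) k) :=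
  Sigma.ext rfl (heq_of_eq (Category.comp_id _))

theorem DetectsPoints.unitFirst {I x y : A.base} (g : x ⟶ y) :
    DetectsPoints I ((unitFirst A).functor.map g) := by
  rintro n k θ p ⟨q, hq⟩
  rw [Points.unitFirst_restrict] at hq
  exact ⟨⟨⟨⟩, q.2⟩, Sigma.ext rfl (Sigma.mk.inj hq).2⟩

/-- `Hom(I[n], {pt, x}) = Hom(I, x)` for constant diagrams on the one-point simplicial set. -/
noncomputable def unitFirstCorep (I : A.base) (n : SimplexCategory) :
    ((unitFirst A).functor ⋙ coyoneda.obj (op ((pointDiagram I).obj n))).CorepresentableBy I where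
  homEquiv {x} := (Equiv.uniqueSigma
      (fun s : PUnit => I ⟶ ((unitFirst A).functor.obj x).diag.obj ⟨op n, s⟩)).symm.trans
    (Points.homEquiv I ((unitFirst A).functor.obj x) n).symm
  homEquiv_comp {x y} g f := by
    refine (Points.homEquiv I ((unitFirst A).functor.obj y) n).injective ?_
    refine (Equiv.apply_symm_apply _ _).trans ?_
    refine Eq.trans ?_ (Points.ofHom_comp _ ((unitFirst A).functor.map g)).symm
    refine Eq.trans ?_ (congrArg _ (Equiv.apply_symm_apply (Points.homEquiv I _ n) _).symm)
    exact Sigma.ext rfl (heq_of_eq (congrArg (f ≫ ·) (unitFirst_trans_app g _).symm))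

end UnitFirst

namespace Stage

theorem mulFirst_restricts {S : Stage.{u}} (hS : S.AllMono) :
    Restricts (S := S.next.next) (T := S.next) (mulFirst S.amb) where
  obj x hx := (mem_next_obj_iff ((mulFirst S.amb).functor.obj x)).2
    ⟨fun a => (hx.2.1 ⟨a.1, a.2.1⟩).2.1 ⟨a.1, a.2.2⟩, fun a b α =>
      S.sub.comp_mem _ _ ((hx.2.1 _).2.1 _) ((hx.2.1 _).2.1 _) ((hx.2.1 _).2.1 _)
        ((hx.2.2 _).1.2 _) ((hx.2.1 _).2.2 _)⟩
  hom x y g hx hy hg := by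
    obtain ⟨h₁, h₂, h₃⟩ := (mem_next_hom_iff hS.next g).1 hg
    have h₄ := fun a => (mem_next_hom_iff hS _).1 (h₂ a)
    refine (mem_next_hom_iff hS ((mulFirst S.amb).functor.map g)).2
      ⟨?_, fun a => ?_, fun I hI => ?_⟩
    · exact mono_diag (SemiObj.Hom.idx ((assoc sSetDiagram sSetDiagram S.amb).functor.map g)) h₁
        fun a => (h₄ a).1
    · exact (congrArg (S.sub.hom ·) (mulFirst_trans_app g a.2.1 a.2.2)).mpr ((h₄ _).2.1 _)
    · exact DetectsPoints.mulFirst (fun n => h₃ _ ⟨I, hI, n, rfl⟩) fun a => (h₄ a).2.2 I hI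

theorem mulFirst_corep (S : Stage.{u}) :
    CorepGenerators (S := S.next.next) (T := S.next) (mulFirst S.amb) := by
  rintro _ ⟨I, hI, n, rfl⟩
  exact ⟨_, ⟨_, ⟨I, hI, n, rfl⟩, n, rfl⟩, ⟨mulFirstCorep I (SimplexCategory.mk n)⟩⟩

theorem unitFirst_restricts {S : Stage.{u}} (hS : S.AllMono) :
    Restricts (S := S) (T := S.next) (unitFirst S.amb) where
  obj x hx := (mem_next_obj_iff ((unitFirst S.amb).functor.obj x)).2
    ⟨fun _ => hx, fun _ _ _ => S.sub.id_mem x hx⟩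
  hom x y g hx hy hg := (mem_next_hom_iff hS ((unitFirst S.amb).functor.map g)).2
    ⟨by
      refine @NatTrans.mono_of_mono_app _ _ _ _ _ _ _ fun n => ?_
      rw [mono_iff_injective]
      exact fun _ _ _ => rfl,
    fun a => (congrArg (S.sub.hom ·) (unitFirst_trans_app g a)).mpr hg,
    fun _ _ => DetectsPoints.unitFirst g⟩

theorem unitFirst_corep (S : Stage.{u}) :
    CorepGenerators (S := S) (T := S.next) (unitFirst S.amb) := by
  rintro _ ⟨I, hI, n, rfl⟩
  exact ⟨I, hI, ⟨unitFirstCorep I (SimplexCategory.mk n)⟩⟩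

theorem Restricts.id (S : Stage.{u}) : Restricts (S := S) (T := S) (𝟙 S.amb) :=
  ⟨fun _ h => h, fun _ _ _ _ _ h => h⟩

theorem Restricts.comp {S T U : Stage.{u}} {m : S.amb ⟶ T.amb} {n : T.amb ⟶ U.amb}
    (hm : Restricts m) (hn : Restricts n) : Restricts (m ≫ n) :=
  ⟨fun _ h => hn.obj _ (hm.obj _ h), fun _ _ _ hx hy h =>
    hn.hom _ (hm.obj _ hx) (hm.obj _ hy) (hm.hom _ hx hy h)⟩

end Stage

/-! ### Multiplications and units preserve the iterated subcategories -/

section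

open Stage

theorem ssetPow_allMono : ∀ k : ℕ, (ssetPow.{u} k).AllMono
  | 0 => fun _ _ _ h => h
  | k + 1 => (ssetPow_allMono k).next

theorem unitPow_allMono : ∀ k : ℕ, (unitPow.{u} k).AllMono
  | 0 => fun _ _ _ _ => ⟨fun _ _ _ => rfl⟩
  | k + 1 => (unitPow_allMono k).next

/-- Corepresentability of the generators is part of the claim because the induction needs it. -/
theorem mulAt_restricts : ∀ (k : ℕ) (i : Fin (k + 1)),
    Restricts (S := ssetPow.{u} (k + 1)) (T := ssetPow k) (mulAt k i) ∧
      CorepGenerators (S := ssetPow.{u} (k + 1)) (T := ssetPow k) (mulAt k i)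
  | 0, _ => ⟨⟨fun _ _ => trivial, fun _ _ g _ _ hg => mono_diag g hg.1.1 hg.1.2⟩, by
      rintro _ ⟨n, rfl⟩
      exact ⟨_, ⟨_, ⟨n, rfl⟩, n, rfl⟩, ⟨sSetMulCorep (SimplexCategory.mk n)⟩⟩⟩
  | k + 1, ⟨0, _⟩ => ⟨mulFirst_restricts (ssetPow_allMono k), mulFirst_corep (ssetPow k)⟩
  | k + 1, ⟨i + 1, h⟩ =>
    have ih := mulAt_restricts k ⟨i, Nat.lt_of_succ_lt_succ h⟩
    ⟨ih.1.semiMap (ssetPow_allMono (k + 1)) (ssetPow_allMono k) ih.2, ih.2.semiMap⟩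

theorem unitAt_restricts : ∀ (k : ℕ) (i : Fin (k + 1)),
    Restricts (S := ssetPow.{u} k) (T := ssetPow (k + 1)) (unitAt k i) ∧
      CorepGenerators (S := ssetPow.{u} k) (T := ssetPow (k + 1)) (unitAt k i)
  | 0, ⟨0, _⟩ => ⟨unitFirst_restricts (ssetPow_allMono 0), unitFirst_corep (ssetPow 0)⟩
  | k + 1, ⟨0, _⟩ =>
    ⟨unitFirst_restricts (ssetPow_allMono (k + 1)), unitFirst_corep (ssetPow (k + 1))⟩
  | k + 1, ⟨i + 1, h⟩ =>
    have ih := unitAt_restricts k ⟨i, Nat.lt_of_succ_lt_succ h⟩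
    ⟨ih.1.semiMap (ssetPow_allMono k) (ssetPow_allMono (k + 1)) ih.2, ih.2.semiMap⟩

/-- There is one morphism from `Δ[n]` to the one-point simplicial set. -/
def sSetUnitCorep (n : SimplexCategory) :
    (sSetUnit.functor ⋙ coyoneda.obj (op (SSet.stdSimplex.{u}.obj n))).CorepresentableBy
      PtIdx.pt where
  homEquiv {_} :=
    { toFun _ := { app _ := TypeCat.ofHom fun _ => PUnit.unit }
      invFun _ := ⟨⟩
      left_inv _ := rfl
      right_inv _ := rfl }
  homEquiv_comp _ _ := rfl

theorem lastUnit_restricts : ∀ k : ℕ,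
    Restricts (S := unitPow.{u} k) (T := ssetPow k) (lastUnit k) ∧
      CorepGenerators (S := unitPow.{u} k) (T := ssetPow k) (lastUnit k)
  | 0 => ⟨⟨fun _ _ => trivial, fun _ _ _ _ _ _ => by
      change Mono (C := SSet.{u}) (𝟙 ((Functor.const _).obj PUnit))
      infer_instance⟩, by
      rintro _ ⟨n, rfl⟩
      exact ⟨PtIdx.pt, trivial, ⟨sSetUnitCorep (SimplexCategory.mk n)⟩⟩⟩
  | k + 1 =>
    have ih := lastUnit_restricts k
    ⟨ih.1.semiMap (unitPow_allMono k) (ssetPow_allMono k) ih.2, ih.2.semiMap⟩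

theorem rightUnitor_restricts :
    Restricts (S := unitPow.{u} 1) (T := ssetPow 0) (rightUnitor sSetDiagram) where
  obj _ _ := trivial
  hom _ _ _ _ _ hg := hg.1.1

end

/-! ### Restricted morphisms and their canonical isomorphisms -/

namespace Stage

/-- The restriction of a morphism of ambient diagrams to the subcategories. -/
def Restricts.restrict {S T : Stage.{u}} {m : S.amb ⟶ T.amb} (h : Restricts m) :
    S.diagram ⟶ T.diagram where
  functor :=
    { obj x := ⟨m.functor.obj x.val, h.obj _ x.mem⟩
      map {x y} f := ⟨m.functor.map f.1, h.hom _ x.mem y.mem f.2⟩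
      map_id x := Subtype.ext (m.functor.map_id x.val)
      map_comp f g := Subtype.ext (m.functor.map_comp f.1 g.1) }
  trans := Functor.whiskerLeft S.sub.incl m.trans

theorem Restricts.restrict_incl {S T : Stage.{u}} {m : S.amb ⟶ T.amb} (h : Restricts m) :
    h.restrict ≫ T.incl = S.incl ≫ m := by
  refine congrArg (CatDiagram.Hom.mk _) ?_
  refine NatTrans.ext (funext fun x => ?_)
  exact (Category.id_comp _).trans (Category.comp_id _).symm

theorem Restricts.restrict_comp {S T U : Stage.{u}} {m : S.amb ⟶ T.amb} {n : T.amb ⟶ U.amb}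
    (hm : Restricts m) (hn : Restricts n) :
    hm.restrict ≫ hn.restrict = (hm.comp hn).restrict := rfl

end Stage

open Stage in
/-- Two morphisms with values in the diagram `sset` are canonically isomorphic if the underlying morphisms
with values in `SSet` are compatibly isomorphic and the simplices of the second simplicial set are
determined by their images in the diagram: the last condition makes the isomorphism unique. -/
theorem canonicallyIso_restrict {S : Stage.{u}} {m n : S.amb ⟶ sSetDiagram.{u}}
    (hm : Restricts (T := ssetPow 0) m) (hn : Restricts (T := ssetPow 0) n)
    (inj : ∀ d, Function.Injective (n.trans.app d).toFunctor.obj) (θ : m.functor ≅ n.functor)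
    (hθ : ∀ d, sSetDiagram.fib.map (θ.hom.app d) ≫ n.trans.app d = m.trans.app d) :
    CanonicallyIso hm.restrict hn.restrict := by
  have hmono : ∀ {X Y : SSet.{u}} (e : X ≅ Y), ssetSubcat.hom e.hom := fun e =>
    inferInstanceAs (Mono e.hom)
  refine ⟨NatIso.ofComponents (fun d =>
    { hom := ⟨(θ.app d.val).hom, hmono (θ.app d.val)⟩
      inv := ⟨(θ.app d.val).inv, hmono (θ.app d.val).symm⟩
      hom_inv_id := Subtype.ext (θ.app d.val).hom_inv_id
      inv_hom_id := Subtype.ext (θ.app d.val).inv_hom_id })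
    fun f => Subtype.ext (θ.hom.naturality f.1), fun d => hθ d.val, fun θ' h' => ?_⟩
  refine Iso.ext (NatTrans.ext (funext fun d => Subtype.ext ?_))
  refine NatTrans.ext (funext fun k => ConcreteCategory.hom_ext _ _ fun s => ?_)
  have e := (h' d).trans (hθ d.val).symm
  have e₁ := inj d.val (congrArg (fun F => F.toFunctor.obj ⟨k, s⟩) e)
  exact eq_of_heq (Sigma.mk.inj e₁).2

/-! ### The monoid laws -/

section

open Stage

/-- The two ways of taking the diagonal of a trisimplicial set agree, `((s, t), w) ↦ (s, (t, w))`. -/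
def diagAssocIso (X : SemiObj sSetDiagram.{u} (SemiObj sSetDiagram.{u} SSet.{u})) :
    diagObj ((mulFirst sSetDiagram).functor.obj X) ≅ diagObj ((semiMapId sSetMul).obj X) :=
  NatIso.ofComponents (fun k => (Equiv.sigmaAssoc fun (s : X.idx.obj k)
    (t : (X.diag.obj ⟨k, s⟩).idx.obj k) => ((X.diag.obj ⟨k, s⟩).diag.obj ⟨k, t⟩).obj k).toIso) <| by
    intro n k θ
    refine ConcreteCategory.hom_ext _ _ fun p => ?_
    obtain ⟨⟨s, t⟩, w⟩ := p
    refine Sigma.ext rfl (heq_of_eq (Sigma.ext rfl (heq_of_eq ?_)))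
    have h := (SemiObj.Hom.trans (X.diag.map (CategoryOfElements.homMk (F := X.idx) ⟨n, s⟩
      ⟨k, X.idx.map θ s⟩ θ rfl))).naturality (CategoryOfElements.homMk
        (F := (X.diag.obj ⟨n, s⟩).idx) ⟨n, t⟩ ⟨k, (X.diag.obj ⟨n, s⟩).idx.map θ t⟩ θ rfl)
    exact (ConcreteCategory.congr_hom (congrArg (fun f => NatTrans.app f k) h)
      (((X.diag.obj ⟨n, s⟩).diag.obj ⟨n, t⟩).map θ w)).symm

/-- Both diagonals send a simplex `(s, t, w)` to the triple of its components. -/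
theorem diagAssocIso_trans (X : SemiObj sSetDiagram.{u} (SemiObj sSetDiagram.{u} SSet.{u})) :
    Functor.elementsFunctor.map (diagAssocIso X).hom ≫
        sSetMul.trans.app ((semiMapId sSetMul).obj X) ≫
          (semiMap (𝟙 sSetDiagram) sSetMul).trans.app X =
      sSetMul.trans.app ((mulFirst sSetDiagram).functor.obj X) ≫
        (mulFirst sSetDiagram).trans.app X := by
  apply Cat.Hom.ext
  refine Functor.hext (fun p => rfl) fun p q f => ?_
  refine total_hext rfl rfl HEq.rfl ?_
  refine HEq.trans (eqToHom_comp_heq _ _) ?_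
  refine total_hext ?_ rfl ?_ ?_
  · rfl
  · refine elements_hext ?_ _ _ ?_
    · rfl
    · rfl
  · refine HEq.trans ?_ (eqToHom_comp_heq _ _).symm
    refine HEq.trans ?_ (eqToHom_comp_heq _ _).symm
    refine elements_hext ?_ _ _ ?_
    · rfl
    · rfl

theorem diagAssocIso_naturality {X Y : SemiObj sSetDiagram.{u} (SemiObj sSetDiagram.{u} SSet.{u})}
    (g : X ⟶ Y) :
    diagFunctor.map ((mulFirst sSetDiagram).functor.map g) ≫ (diagAssocIso Y).hom =
      (diagAssocIso X).hom ≫ diagFunctor.map ((semiMapId sSetMul).map g) := by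
  refine NatTrans.ext (funext fun k => ConcreteCategory.hom_ext _ _ fun p => ?_)
  obtain ⟨⟨s, t⟩, w⟩ := p
  have h₁ := ConcreteCategory.congr_hom (congrArg (fun t => NatTrans.app t k)
    (mulFirst_trans_app (A := sSetDiagram) g s t)) w
  have h₂ := ConcreteCategory.congr_hom (congrArg (fun t => NatTrans.app t k)
    (semiMapId_trans_app sSetMul g ⟨k, s⟩)) (⟨t, w⟩ : (diagObj (X.diag.obj ⟨k, s⟩)).obj k)
  refine Eq.trans (b := (⟨(SemiObj.Hom.idx g).app k s,
    ((diagFunctor.map ((SemiObj.Hom.trans g).app ⟨k, s⟩)).app k ⟨t, w⟩)⟩ :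
      (diagObj ((semiMapId sSetMul).obj Y)).obj k)) ?_ ?_
  · exact congrArg (fun w => (⟨(SemiObj.Hom.idx g).app k s,
      ⟨(SemiObj.Hom.idx ((SemiObj.Hom.trans g).app ⟨k, s⟩)).app k t, w⟩⟩ :
        (diagObj ((semiMapId sSetMul).obj Y)).obj k)) h₁
  · exact congrArg (fun z => (⟨(SemiObj.Hom.idx g).app k s, z⟩ :
      (diagObj ((semiMapId sSetMul).obj Y)).obj k)) h₂.symm

/-- A simplex of the iterated diagonal is determined by the triple of its components. -/
theorem diag_trans_injective (X : SemiObj sSetDiagram.{u} (SemiObj sSetDiagram.{u} SSet.{u})) :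
    Function.Injective (sSetMul.trans.app ((semiMapId sSetMul).obj X) ≫
      (semiMap (𝟙 sSetDiagram) sSetMul).trans.app X).toFunctor.obj := by
  rintro ⟨k, s, t, w⟩ ⟨k', s', t', w'⟩ e
  obtain ⟨e₁, e₂⟩ := Grothendieck.mk.inj e
  obtain ⟨rfl, e₃⟩ := Sigma.mk.inj e₁
  obtain rfl := eq_of_heq e₃
  obtain ⟨e₄, e₅⟩ := Grothendieck.mk.inj (eq_of_heq e₂)
  obtain rfl := eq_of_heq (Sigma.mk.inj e₄).2
  obtain rfl := eq_of_heq (Sigma.mk.inj (eq_of_heq e₅)).2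
  rfl

/-- The associativity isomorphism of the multiplication of the diagram `SSet`. -/
def mulAssocIso : (mulFirst sSetDiagram ≫ sSetMul.{u}).functor ≅
    (semiMap (𝟙 sSetDiagram) sSetMul ≫ sSetMul.{u}).functor :=
  NatIso.ofComponents diagAssocIso diagAssocIso_naturality

theorem diag_assoc_canonicallyIso
    (h₁ : Restricts (S := ssetPow.{u} 2) (T := ssetPow 0) (mulFirst sSetDiagram ≫ sSetMul.{u}))
    (h₂ : Restricts (S := ssetPow.{u} 2) (T := ssetPow 0)
      (semiMap (𝟙 sSetDiagram) sSetMul ≫ sSetMul.{u})) :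
    CanonicallyIso h₁.restrict h₂.restrict :=
  canonicallyIso_restrict h₁ h₂ diag_trans_injective mulAssocIso diagAssocIso_trans

theorem mul_assoc_canonicallyIso :
    CanonicallyIso ((mulAt_restricts.{u} 1 0).1.restrict ≫ (mulAt_restricts 0 0).1.restrict)
      ((mulAt_restricts 1 1).1.restrict ≫ (mulAt_restricts 0 0).1.restrict) := by
  rw [Restricts.restrict_comp, Restricts.restrict_comp]
  exact diag_assoc_canonicallyIso _ _

/-- The diagonal of a constant diagram on the one-point simplicial set, `(pt, s) ↦ s`. -/
def diagUnitIso (X : SSet.{u}) : diagObj ((unitFirst sSetDiagram).functor.obj X) ≅ X :=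
  NatIso.ofComponents (fun k => (Equiv.uniqueSigma (fun _ : PUnit => X.obj k)).toIso)
    fun _ => rfl

theorem diagUnitIso_trans (X : SSet.{u}) :
    Functor.elementsFunctor.map (diagUnitIso X).hom =
      sSetMul.trans.app ((unitFirst sSetDiagram).functor.obj X) ≫
        (unitFirst sSetDiagram).trans.app X := by
  apply Cat.Hom.ext
  refine Functor.hext (fun p => rfl) fun p q f => ?_
  refine HEq.trans ?_ (eqToHom_comp_heq _ _).symm
  refine HEq.trans ?_ (eqToHom_comp_heq _ _).symm
  rfl

theorem unit_mul_canonicallyIso :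
    CanonicallyIso ((unitAt_restricts.{u} 0 0).1.restrict ≫ (mulAt_restricts 0 0).1.restrict)
      (𝟙 _) :=
  canonicallyIso_restrict ((unitAt_restricts.{u} 0 0).1.comp (mulAt_restricts 0 0).1)
    (Restricts.id _) (fun _ _ _ e => e) (NatIso.ofComponents diagUnitIso fun _ => rfl)
    fun X => (Category.comp_id _).trans (diagUnitIso_trans X)

/-- The diagonal of a diagram of one-point simplicial sets, `(s, pt) ↦ s`. -/
def diagLastUnitIso (X : SemiObj sSetDiagram.{u} PtIdx.{u}) :
    diagObj ((semiMapId sSetUnit).obj X) ≅ X.idx :=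
  NatIso.ofComponents (fun k => (Equiv.sigmaPUnit (X.idx.obj k)).toIso) fun _ => rfl

theorem diagLastUnitIso_trans (X : SemiObj sSetDiagram.{u} PtIdx.{u}) :
    Functor.elementsFunctor.map (diagLastUnitIso X).hom ≫ (rightUnitor sSetDiagram).trans.app X =
      sSetMul.trans.app ((semiMapId sSetUnit).obj X) ≫
        (semiMap (𝟙 sSetDiagram) sSetUnit).trans.app X := by
  apply Cat.Hom.ext
  refine Functor.hext (fun p => rfl) fun p q f => ?_
  exact total_hext rfl rfl HEq.rfl HEq.rfl

theorem mul_unit_canonicallyIso :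
    CanonicallyIso ((lastUnit_restricts.{u} 1).1.restrict ≫ (mulAt_restricts 0 0).1.restrict)
      rightUnitor_restricts.restrict :=
  canonicallyIso_restrict ((lastUnit_restricts.{u} 1).1.comp (mulAt_restricts 0 0).1)
    rightUnitor_restricts (fun _ _ _ e => congrArg Grothendieck.base e)
    (NatIso.ofComponents diagLastUnitIso fun _ => rfl) diagLastUnitIso_trans

end

theorem mainTheorem2 :
    ∃ (μ : ∀ (k : ℕ) (_ : Fin (k + 1)), (ssetPow.{u} (k + 1)).diagram ⟶ (ssetPow.{u} k).diagram)
      (η : ∀ (k : ℕ) (_ : Fin (k + 1)), (ssetPow.{u} k).diagram ⟶ (ssetPow.{u} (k + 1)).diagram)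
      (ε : ∀ k : ℕ, (unitPow.{u} k).diagram ⟶ (ssetPow.{u} k).diagram)
      (r : (unitPow.{u} 1).diagram ⟶ (ssetPow.{u} 0).diagram),
      (∀ k i, μ k i ≫ (ssetPow k).incl = (ssetPow (k + 1)).incl ≫ mulAt k i) ∧
      (∀ k i, η k i ≫ (ssetPow (k + 1)).incl = (ssetPow k).incl ≫ unitAt k i) ∧
      (∀ k, ε k ≫ (ssetPow k).incl = (unitPow k).incl ≫ lastUnit k) ∧
      r ≫ (ssetPow 0).incl = (unitPow 1).incl ≫ rightUnitor sSetDiagram ∧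
      CanonicallyIso (μ 1 0 ≫ μ 0 0) (μ 1 1 ≫ μ 0 0) ∧
      CanonicallyIso (η 0 0 ≫ μ 0 0) (𝟙 _) ∧
      CanonicallyIso (ε 1 ≫ μ 0 0) r := by
  refine ⟨fun k i => (mulAt_restricts k i).1.restrict, fun k i => (unitAt_restricts k i).1.restrict,
    fun k => (lastUnit_restricts k).1.restrict, rightUnitor_restricts.restrict,
    fun k i => (mulAt_restricts k i).1.restrict_incl, fun k i =>
      (unitAt_restricts k i).1.restrict_incl, fun k => (lastUnit_restricts k).1.restrict_incl,
    rightUnitor_restricts.restrict_incl, mul_assoc_canonicallyIso,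
    unit_mul_canonicallyIso, mul_unit_canonicallyIso⟩
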